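/- Let $B_{n+1}$ be the Boolean lattice of all subsets of $[n+1]$, ordered by inclusion. For $S\subseteq[n]$ let $f_S$ be the number of chains in $B_{n+1}$ whose set of ranks is $S$, let $h_S=\sum_{T\subseteq S}(-1)^{|S\setminus T|}f_T$, and let $\sum_{S\subseteq [n]} h_S u_S$ be the $\mathbf{ab}$-index of $B_{n+1}$, where $u_S=u_1\cdots u_n$ with $u_i=\mathbf b$ for $i\in S$ and $u_i=\mathbf a$ for $i\notin S$. It can be written uniquely as a polynomial $\Psi(B_{n+1})$ in the non-commuting variables $\mathbf c=\mathbf a+\mathbf b$ and $\mathbf d=\mathbf a\mathbf b+\mathbf b\mathbf a$ (the $\mathbf{cd}$-index). Give $\mathbf c$ degree $1$ and $\mathbf d$ degree $2$, and for a $\mathbf{cd}$-monomial $v$ of degree $n$ let $\beta(v)$ be the coefficient of $v$ in $\Psi(B_{n+1})$. The list $(m_1,\dots,m_k)$ of non-negative integers denotes the monomial $\mathbf c^{m_1}\mathbf d\,\mathbf c^{m_2}\mathbf d\cdots\mathbf d\,\mathbf c^{m_k}$. Theorem. (Even degree.) For every $n\ge 0$, $\beta$ attains its maximum among all $\mathbf{cd}$-monomials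 of degree $2n+2$ at $\mathbf c\,\mathbf d^{n}\mathbf c$. If $n\ge 1$, this is the only monomial at which the maximum is attained; in the list notation it is $(1,0,\dots,0,1)$, with $n-1$ zeros. (Odd degree.) For every $n\ge 1$, the $\mathbf{cd}$-monomials of degree $2n+5$ at which $\beta$ attains its maximum are exactly $\mathbf c\,\mathbf d\,\mathbf c\,\mathbf d^{n}\mathbf c$ and $\mathbf c\,\mathbf d^{n}\mathbf c\,\mathbf d\,\mathbf c$ (which coincide for $n=1$); in the list notation they are $(1,1,0,\dots,0,1)$ and $(1,0,\dots,0,1,1)$, each with $n-1$ zeros. -/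

import Mathlib

namespace BooleanCD

/-- The two letters of the noncommutative variables `a`, `b`. -/
inductive AB
  | a
  | b

/-- The two letters of the noncommutative variables `c`, `d`. -/
inductive CD
  | c
  | d

/-- `ℤ⟨a, b⟩`: noncommutative polynomials in `a` and `b`. -/
abbrev ABPoly := MonoidAlgebra ℤ (FreeMonoid AB)

/-- `cd`-monomials: words in the letters `c` and `d`; the empty word is `1`. -/
abbrev CDMonomial := FreeMonoid CD

/-- `ℤ⟨c, d⟩`: noncommutative polynomials in `c` and `d`. -/
abbrev CDPoly := MonoidAlgebra ℤ CDMonomial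

/-- The `cd`-monomial `c`. -/
def c : CDMonomial := FreeMonoid.of CD.c

/-- The `cd`-monomial `d`. -/
def d : CDMonomial := FreeMonoid.of CD.d

/-- The degree of a letter: `deg c = 1` and `deg d = 2`. -/
def CD.degree : CD → ℕ
  | CD.c => 1
  | CD.d => 2

/-- The degree of a `cd`-monomial. -/
def degree (v : CDMonomial) : ℕ := (v.toList.map CD.degree).sum

/-- The entry `f_S` of the flag `f`-vector of a graded poset of rank `n + 1`: the number of chains
whose set of ranks is `S`.  Here `i : Fin n` stands for the rank `i + 1 ∈ {1, …, n}`. -/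
noncomputable def flagF (P : Type*) [PartialOrder P] [GradeMinOrder ℕ P] (n : ℕ)
    (S : Finset (Fin n)) : ℕ :=
  {C : Set P | IsChain (· ≤ ·) C ∧
    grade ℕ '' C = (fun i : Fin n => (i : ℕ) + 1) '' (S : Set (Fin n))}.ncard

/-- The flag `h`-vector: `h_S = ∑_{T ⊆ S} (-1)^{|S - T|} f_T`. -/
noncomputable def flagH (P : Type*) [PartialOrder P] [GradeMinOrder ℕ P] (n : ℕ)
    (S : Finset (Fin n)) : ℤ :=
  ∑ T ∈ S.powerset, (-1) ^ (S \ T).card * (flagF P n T : ℤ)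

open Classical in
/-- The word `u_S = u_1 u_2 ⋯ u_n` with `u_i = b` if `i ∈ S` and `u_i = a` otherwise. -/
noncomputable def abWord (n : ℕ) (S : Finset (Fin n)) : FreeMonoid AB :=
  FreeMonoid.ofList (List.ofFn fun i : Fin n => if i ∈ S then AB.b else AB.a)

/-- The `ab`-index `∑_S h_S u_S` of a graded poset of rank `n + 1`. -/
noncomputable def abIndex (P : Type*) [PartialOrder P] [GradeMinOrder ℕ P] (n : ℕ) : ABPoly :=
  ∑ S : Finset (Fin n), MonoidAlgebra.single (abWord n S) (flagH P n S)

/-- The variable `a` of `ℤ⟨a, b⟩`. -/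
noncomputable def aVar : ABPoly := MonoidAlgebra.of ℤ (FreeMonoid AB) (FreeMonoid.of AB.a)

/-- The variable `b` of `ℤ⟨a, b⟩`. -/
noncomputable def bVar : ABPoly := MonoidAlgebra.of ℤ (FreeMonoid AB) (FreeMonoid.of AB.b)

/-- The value of a letter under the substitution `c = a + b`, `d = ab + ba`. -/
noncomputable def CD.toAB : CD → ABPoly
  | CD.c => aVar + bVar
  | CD.d => aVar * bVar + bVar * aVar

/-- The substitution `c = a + b`, `d = ab + ba` in a noncommutative polynomial in `c` and `d`. -/
noncomputable def substAB : CDPoly →ₐ[ℤ] ABPoly :=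
  MonoidAlgebra.lift ℤ ABPoly CDMonomial (FreeMonoid.lift CD.toAB)

/-- `Φ` is a `cd`-index of the graded poset `P` of rank `n + 1`: the substitution `c = a + b`,
`d = ab + ba` turns it into the `ab`-index of `P`. -/
def IsCDIndex (P : Type*) [PartialOrder P] [GradeMinOrder ℕ P] (n : ℕ) (Φ : CDPoly) : Prop :=
  substAB Φ = abIndex P n

open Classical in
/-- The `cd`-index `Ψ(P)` of a graded poset `P` of rank `n + 1` (and `0` if there is none). -/
noncomputable def cdIndex (P : Type*) [PartialOrder P] [GradeMinOrder ℕ P] (n : ℕ) : CDPoly :=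
  if h : ∃ Φ : CDPoly, IsCDIndex P n Φ then h.choose else 0

/-- The Boolean lattice `B_m` of all subsets of an `m`-element set, ordered by inclusion and
graded by cardinality. -/
abbrev BooleanLattice (m : ℕ) := Finset (Fin m)

/-- `β(v)`, for a `cd`-monomial `v` of degree `n`, is the coefficient of `v` in `Ψ(B_{n+1})`. -/
noncomputable def beta (v : CDMonomial) : ℤ :=
  (cdIndex (BooleanLattice (degree v + 1)) (degree v)).coeff v

/-- The set of maxima: the `cd`-monomials of degree `N` whose `β` value is largest among all
`cd`-monomials of degree `N`. -/
def maxima (N : ℕ) : Set CDMonomial :=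
  {v | degree v = N ∧ ∀ w : CDMonomial, degree w = N → beta w ≤ beta v}

/-- The `cd`-monomial `c^{m₁} d c^{m₂} d ⋯ d c^{m_k}` represented by the nonempty list
`(m₁, …, m_k)`. -/
def ofList (L : List ℕ) : CDMonomial := ((L.map fun m => c ^ m).intersperse d).prod

end BooleanCD

namespace BooleanCD

/-! Write Δ for the coproduct with Δ(a) = Δ(b) = 1⊗1, so that Δ(c) = 2·1⊗1 and Δ(d) = c⊗1 + 1⊗c, and
let D(P) = Pc + G(P), where G is the derivation with G(c) = d and G(d) = cd. On coefficient
functions, `lowerSum` is the action of D and `cut` that of Δ. The polynomials obtained from 1 by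
iterating D have coefficients `level`.

They are the cd-indices of the Boolean lattices: D is compatible with Δ (`cut_lowerSum`), so Δ of
the n-th polynomial is a binomial convolution of the earlier ones (`cut_level`). Pairing with a flag
word then obeys the recursion that counts chains by their largest member (`card_chainsIn`). Since
the substitution for c and d is injective, this gives existence and uniqueness, and `beta_eq_level`.

Two facts locate the maxima. Replacing cc by d increases the coefficient (`level_cc`), so only words
d^{a_0} c d^{a_1} c ⋯ c d^{a_k} with nonempty interior blocks matter. For an isolated c, a single
term of `cut` survives, so the coefficient divided by (degree + 1)! is multiplicative up to a factor
1/2 (`weight_append_c`); on powers of d it is τ_a / 2^a, with τ_a the coefficient of x^{2a+1} in tan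
x (`weight_replicate_d`).

It remains to compare products of the τ_a. By Euler's formula for ζ(2k) they are moments of a
positive measure with several atoms, hence strictly log-convex: τ_{k+a} τ_{k+b} ≤ τ_k τ_{k+a+b}.
With τ_0 = 1 the end blocks are absorbed into an interior one; with τ_1 = 1/3 interior blocks are
merged; numerical bounds on τ_{a+1}/τ_a settle the change in the number of letters c. In even degree
one interior block between two end letters c wins. In odd degree two interior blocks remain, and
equality in log-convexity forces one of them to be a single d. -/

/-! ### The operator D and the coproduct, on coefficient functions -/

/-- The degree of a word in the letters `c` and `d`. -/
def wdeg (v : List CD) : ℕ := (v.map CD.degree).sum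

@[simp] lemma wdeg_nil : wdeg [] = 0 := rfl
@[simp] lemma wdeg_c (v : List CD) : wdeg (CD.c :: v) = wdeg v + 1 := by
  simp [wdeg, CD.degree, add_comm]
@[simp] lemma wdeg_d (v : List CD) : wdeg (CD.d :: v) = wdeg v + 2 := by
  simp [wdeg, CD.degree, add_comm]
@[simp] lemma wdeg_append (u v : List CD) : wdeg (u ++ v) = wdeg u + wdeg v := by
  simp [wdeg]

/-- `x` if the word does not start with `c`, and `0` otherwise. -/
def unlessC (x : ℤ) : List CD → ℤ
  | [] => x
  | CD.c :: _ => 0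
  | CD.d :: _ => x

/-- The value of `γ` at the word without its first letter if that letter is `c`, and `0`
otherwise. -/
def afterC (γ : List CD → ℤ) : List CD → ℤ
  | [] => 0
  | CD.c :: w => γ w
  | CD.d :: _ => 0

@[simp] lemma unlessC_nil (x : ℤ) : unlessC x [] = x := rfl
@[simp] lemma unlessC_c (x : ℤ) (v : List CD) : unlessC x (CD.c :: v) = 0 := rfl
@[simp] lemma unlessC_d (x : ℤ) (v : List CD) : unlessC x (CD.d :: v) = x := rfl
@[simp] lemma afterC_c (γ : List CD → ℤ) (v : List CD) : afterC γ (CD.c :: v) = γ v := rfl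

/-- The sum of `γ` over all words obtained from a given one by replacing a letter `d` by `c` or by
removing a letter `c` from a maximal run of letters `c`. -/
def lowerSum (γ : List CD → ℤ) : List CD → ℤ
  | [] => 0
  | CD.c :: v => unlessC (γ v) v + lowerSum (fun u => γ (CD.c :: u)) v
  | CD.d :: v => γ (CD.c :: v) + lowerSum (fun u => γ (CD.d :: u)) v

lemma lowerSum_congr {v : List CD} : ∀ {γ δ : List CD → ℤ},
    (∀ u, wdeg u + 1 = wdeg v → γ u = δ u) → lowerSum γ v = lowerSum δ v := by
  induction v with
  | nil => intros; rfl
  | cons x v ih =>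
    intro γ δ h
    cases x with
    | c =>
      have h1 : γ v = δ v := h v (by simp)
      have h2 := ih (γ := fun u => γ (CD.c :: u)) (δ := fun u => δ (CD.c :: u))
        (fun u hu => h _ (by simp; omega))
      simp only [lowerSum, h1, h2]
    | d =>
      have h1 : γ (CD.c :: v) = δ (CD.c :: v) := h _ (by simp)
      have h2 := ih (γ := fun u => γ (CD.d :: u)) (δ := fun u => δ (CD.d :: u))
        (fun u hu => h _ (by simp; omega))
      simp only [lowerSum, h1, h2]

lemma unlessC_add (x y : ℤ) (v : List CD) : unlessC (x + y) v = unlessC x v + unlessC y v := by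
  rcases v with _ | ⟨_ | _, v⟩ <;> simp [unlessC]

lemma unlessC_mul (k x : ℤ) (v : List CD) : unlessC (k * x) v = k * unlessC x v := by
  rcases v with _ | ⟨_ | _, v⟩ <;> simp [unlessC]

lemma afterC_add (γ δ : List CD → ℤ) (v : List CD) :
    afterC (fun u => γ u + δ u) v = afterC γ v + afterC δ v := by
  rcases v with _ | ⟨_ | _, v⟩ <;> simp [afterC]

lemma lowerSum_add (v : List CD) : ∀ γ δ : List CD → ℤ,
    lowerSum (fun u => γ u + δ u) v = lowerSum γ v + lowerSum δ v := by
  induction v with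
  | nil => intros; rfl
  | cons x v ih => intro γ δ; cases x <;> simp only [lowerSum, ih, unlessC_add] <;> ring

lemma lowerSum_mul (v : List CD) : ∀ (k : ℤ) (γ : List CD → ℤ),
    lowerSum (fun u => k * γ u) v = k * lowerSum γ v := by
  induction v with
  | nil => intros; simp [lowerSum]
  | cons x v ih => intro γ δ; cases x <;> simp only [lowerSum, ih, unlessC_mul] <;> ring

lemma lowerSum_zero (v : List CD) : lowerSum (fun _ => 0) v = 0 := by
  simpa using lowerSum_mul v 0 (fun _ => 0)

/-- `x` at the empty word and `0` elsewhere. -/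
def atNil (x : ℤ) : List CD → ℤ
  | [] => x
  | _ :: _ => 0

lemma lowerSum_atNil (x : ℤ) (y : CD) (v : List CD) :
    lowerSum (atNil x) (y :: v) = match y with | CD.c => atNil x v | CD.d => 0 := by
  cases y <;> simp only [lowerSum, atNil, lowerSum_zero]
  · rcases v with _ | ⟨_ | _, v⟩ <;> simp [unlessC]
  · simp

/-- The dual of the coproduct: the sum of `γ` over all ways to fill in a letter between `u`
and `w`. -/
def cut (γ : List CD → ℤ) : List CD → List CD → ℤ
  | [], w => 2 * γ (CD.c :: w) + afterC (fun w' => γ (CD.d :: w')) w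
  | CD.c :: u, w => cut (fun v => γ (CD.c :: v)) u w + atNil (γ (CD.d :: w)) u
  | CD.d :: u, w => cut (fun v => γ (CD.d :: v)) u w

lemma atNil_add (x y : ℤ) (v : List CD) : atNil (x + y) v = atNil x v + atNil y v := by
  cases v <;> simp [atNil]

lemma cut_add (u w : List CD) : ∀ γ δ : List CD → ℤ,
    cut (fun v => γ v + δ v) u w = cut γ u w + cut δ u w := by
  induction u with
  | nil => intro γ δ; simp only [cut, afterC_add]; ring
  | cons x u ih => intro γ δ; cases x <;> simp only [cut, ih, atNil_add]; ring

lemma cut_zero (u w : List CD) : cut (fun _ => 0) u w = 0 := by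
  have := cut_add u w (fun _ => 0) (fun _ => 0)
  simp only [add_zero] at this
  linarith

lemma cut_unlessC (γ : List CD → ℤ) (u w : List CD) :
    cut (fun v => unlessC (γ v) v) u w =
      (match u with
        | [] => afterC (fun w' => γ (CD.d :: w')) w
        | CD.c :: u => atNil (γ (CD.d :: w)) u
        | CD.d :: u => cut γ (CD.d :: u) w) := by
  rcases u with _ | ⟨_ | _, u⟩
  · simp [cut, unlessC]
  · simp [cut, unlessC, cut_zero]
  · simp [cut, unlessC]

lemma cut_lowerSum_nil (w : List CD) (γ : List CD → ℤ) :
    cut (lowerSum γ) [] w = γ w + atNil (γ []) w + lowerSum (fun w' => cut γ [] w') w := by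
  have h : ∀ v, lowerSum (fun w' => cut γ [] w') v = 2 * lowerSum (fun w' => γ (CD.c :: w')) v +
      lowerSum (afterC fun w' => γ (CD.d :: w')) v := by
    intro v
    rw [← lowerSum_mul, ← lowerSum_add]; rfl
  rw [h]
  rcases w with _ | ⟨_ | _, w⟩
  · simp [cut, lowerSum, unlessC, afterC, atNil]; ring
  · have : unlessC (afterC (fun w' => γ (CD.d :: w')) w) w = 0 := by
      rcases w with _ | ⟨_ | _, w⟩ <;> simp [unlessC, afterC]
    have h' : lowerSum (afterC fun w' => γ (CD.d :: w')) (CD.c :: w) =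
        lowerSum (fun u => γ (CD.d :: u)) w := by
      simp only [lowerSum, afterC_c, this, zero_add]
    rw [h']
    simp only [cut, lowerSum, unlessC_c, afterC_c, atNil]; ring
  · simp only [cut, lowerSum, unlessC, afterC, atNil, lowerSum_zero]; ring

/-- Dual form of Δ(D(P)) = 1⊗P + P⊗1 + (D⊗1 + 1⊗D)Δ(P). For P the index of a poset this reflects the
product with a two-element chain: the boundary terms come from the two new elements that do not lie
over a proper element of the poset. -/
theorem cut_lowerSum (u w : List CD) : ∀ γ : List CD → ℤ,
    cut (lowerSum γ) u w = atNil (γ w) u + atNil (γ u) w + lowerSum (fun u' => cut γ u' w) u +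
      lowerSum (fun w' => cut γ u w') w := by
  induction u with
  | nil => intro γ; rw [cut_lowerSum_nil]; simp [atNil, lowerSum]
  | cons x u ih =>
    intro γ
    cases x with
    | c =>
      have e1 : cut (lowerSum γ) (CD.c :: u) w = cut (fun v => unlessC (γ v) v) u w +
          cut (lowerSum fun v => γ (CD.c :: v)) u w + atNil (lowerSum γ (CD.d :: w)) u := by
        simp only [cut, lowerSum, cut_add]
      have e2 : lowerSum (fun u' => cut γ u' w) (CD.c :: u) = unlessC (cut γ u w) u +
          lowerSum (fun u' => cut (fun v => γ (CD.c :: v)) u' w) u +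
          lowerSum (atNil (γ (CD.d :: w))) u := by
        simp only [lowerSum, cut, lowerSum_add]; ring
      have e3 : lowerSum (fun w' => cut γ (CD.c :: u) w') w =
          lowerSum (fun w' => cut (fun v => γ (CD.c :: v)) u w') w +
          lowerSum (fun w' => atNil (γ (CD.d :: w')) u) w := by
        simp only [cut, lowerSum_add]
      rw [e1, e2, e3, ih, cut_unlessC]
      rcases u with _ | ⟨_ | _, u⟩
      · simp [atNil, lowerSum, unlessC, cut]; ring
      · simp only [lowerSum_atNil, atNil, unlessC, lowerSum_zero]; ring
      · simp only [lowerSum_atNil, atNil, unlessC, lowerSum_zero]; ring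
    | d =>
      have e1 : cut (lowerSum γ) (CD.d :: u) w = cut (fun v => γ (CD.c :: v)) u w +
          cut (lowerSum fun v => γ (CD.d :: v)) u w := by
        simp only [cut, lowerSum, cut_add]
      rw [e1, ih]
      simp only [lowerSum, cut, atNil]
      ring

/-- `level n v` is the number of maximal chains from `1` to the `cd`-word `v` of degree `n` in the
order generated by the covering relation of `lowerSum`. -/
def level : ℕ → List CD → ℤ
  | 0 => atNil 1
  | n + 1 => lowerSum (level n)

/-- The binomial coefficient counts the elements of rank `wdeg u + 1` in B_{n+2}; the two factors
belong to the intervals below and above such an element. Under `cut_lowerSum` the induction becomes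
Pascal's rule. -/
lemma cut_level (n : ℕ) : ∀ u w : List CD, wdeg u + wdeg w = n →
    cut (level (n + 1)) u w =
      (n + 2).choose (wdeg u + 1) * (level (wdeg u) u * level (wdeg w) w) := by
  induction n with
  | zero =>
    intro u w h
    have hu : u = [] := by rcases u with _ | ⟨_ | _, u⟩ <;> simp_all
    have hw : w = [] := by rcases w with _ | ⟨_ | _, u⟩ <;> simp_all
    subst hu hw
    simp [cut, level, lowerSum, unlessC, atNil, afterC]
  | succ n ih =>
    intro u w h
    have key := cut_lowerSum u w (level (n + 1))
    change cut (level (n + 2)) u w = _ at key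
    have h1 : lowerSum (fun u' => cut (level (n + 1)) u' w) u =
        (n + 2).choose (wdeg u) * (lowerSum (level (wdeg u - 1)) u * level (wdeg w) w) := by
      rw [mul_comm (lowerSum _ _), ← mul_assoc, ← lowerSum_mul]
      refine lowerSum_congr fun u' hu' => ?_
      rw [ih u' w (by omega), hu', ← hu', Nat.add_sub_cancel]; ring
    have h2 : lowerSum (fun w' => cut (level (n + 1)) u w') w =
        (n + 2).choose (wdeg u + 1) * (level (wdeg u) u * lowerSum (level (wdeg w - 1)) w) := by
      rw [← mul_assoc, ← lowerSum_mul]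
      refine lowerSum_congr fun w' hw' => ?_
      rw [ih u w' (by omega), ← hw', Nat.add_sub_cancel]; ring
    have hl : ∀ v : List CD, v ≠ [] → lowerSum (level (wdeg v - 1)) v = level (wdeg v) v := by
      intro v hv
      have : wdeg v = wdeg v - 1 + 1 := by rcases v with _ | ⟨_ | _, u⟩ <;> simp_all
      conv_rhs => rw [this]
      rfl
    rw [key, h1, h2]
    have pas : (n + 1 + 2).choose (wdeg u + 1) = (n + 2).choose (wdeg u) +
      (n + 2).choose (wdeg u + 1) := Nat.choose_succ_succ _ _
    rw [pas]
    -- On an empty word `lowerSum` vanishes, and the boundary term `atNil` supplies the missing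
    -- Pascal summand, which is 1.
    rcases u with _ | ⟨x, u⟩ <;> rcases w with _ | ⟨y, w⟩
    · simp at h
    · rw [hl (y :: w) (by simp)]
      simp only [wdeg_nil, zero_add] at h ⊢
      rw [h]
      simp [atNil, lowerSum, level]; ring
    · rw [hl (x :: u) (by simp)]
      simp only [wdeg_nil, add_zero] at h ⊢
      rw [h]
      simp [atNil, lowerSum, level]; ring
    · rw [hl _ (by simp), hl _ (by simp)]
      simp only [atNil]; push_cast; ring

/-! ### Factorisation at an isolated c -/

/-- A word that does not start with `c`. -/
def NotStartC (w : List CD) : Prop := ∀ w', w ≠ CD.c :: w'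

/-- A word that does not end with `c`. -/
def NotEndC (u : List CD) : Prop := ∀ u', u ≠ u' ++ [CD.c]

/-- Filling the gap with d uses up a c at the end of `u` or at the start of `w`. Without such a
neighbour only the filling by c, of multiplicity 2, is left. -/
lemma cut_of_notC {w : List CD} (hw : NotStartC w) (u : List CD) : ∀ γ : List CD → ℤ,
    NotEndC u → cut γ u w = 2 * γ (u ++ CD.c :: w) := by
  induction u with
  | nil =>
    intro γ _
    rcases w with _ | ⟨_ | _, w⟩
    · simp [cut, afterC]
    · exact absurd rfl (hw w)
    · simp [cut, afterC]
  | cons x u ih =>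
    intro γ h
    have hu : NotEndC u := fun u' e => h (x :: u') (by simp [e])
    cases x with
    | c =>
      rcases u with _ | ⟨y, u⟩
      · exact absurd rfl (h [])
      · rw [cut, ih _ hu]; simp [atNil]
    | d => rw [cut, ih _ hu]; simp

theorem level_append_c {u w : List CD} (hu : NotEndC u) (hw : NotStartC w) :
    2 * level (wdeg u + wdeg w + 1) (u ++ CD.c :: w) =
      (wdeg u + wdeg w + 2).choose (wdeg u + 1) * (level (wdeg u) u * level (wdeg w) w) := by
  rw [← cut_of_notC hw u _ hu, cut_level _ u w rfl]

/-! ### Positivity, and replacing cc by d -/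

lemma unlessC_le {x y : ℤ} (h : x ≤ y) (v : List CD) : unlessC x v ≤ unlessC y v := by
  rcases v with _ | ⟨_ | _, v⟩ <;> simp [unlessC, h]

lemma lowerSum_mono (v : List CD) : ∀ {γ δ : List CD → ℤ}, (∀ u, γ u ≤ δ u) →
    lowerSum γ v ≤ lowerSum δ v := by
  induction v with
  | nil => intros; rfl
  | cons x v ih =>
    intro γ δ h
    cases x
    · exact add_le_add (unlessC_le (h _) _) (ih fun u => h _)
    · exact add_le_add (h _) (ih fun u => h _)

lemma lowerSum_nonneg (v : List CD) {γ : List CD → ℤ} (h : ∀ u, 0 ≤ γ u) : 0 ≤ lowerSum γ v := by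
  simpa [lowerSum_zero] using lowerSum_mono v h

/-- The recursion of `lowerSum` moves a prefix of the word into `γ`. Here `k` is the degree of that
prefix and `N` the degree on which the original function is positive. -/
lemma lowerSum_pos (v : List CD) : ∀ {γ : List CD → ℤ} {k N : ℕ}, (∀ u, 0 ≤ γ u) →
    (∀ u, wdeg u + k = N → 0 < γ u) → v ≠ [] → wdeg v + k = N + 1 → 0 < lowerSum γ v := by
  induction v with
  | nil => intro _ _ _ _ _ h; simp at h
  | cons x v ih =>
    intro γ k N h0 h1 _ hd
    cases x with
    | d =>
      have := h1 (CD.c :: v) (by simp at hd ⊢; omega)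
      have := lowerSum_nonneg v (γ := fun u => γ (CD.d :: u)) fun u => h0 _
      simp only [lowerSum]; omega
    | c =>
      simp only [wdeg_c] at hd
      have := lowerSum_nonneg v (γ := fun u => γ (CD.c :: u)) fun u => h0 _
      have h2 := h1 v (by omega)
      rcases v with _ | ⟨_ | _, v⟩
      · simp only [lowerSum, unlessC] at this ⊢; omega
      · have := ih (γ := fun u => γ (CD.c :: u)) (k := k + 1) (N := N) (fun u => h0 _)
          (fun u hu => h1 _ (by simp; omega)) (by simp) (by omega)
        rw [lowerSum, unlessC]; omega
      · rw [lowerSum, unlessC]; omega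

lemma level_nonneg (n : ℕ) : ∀ v, 0 ≤ level n v := by
  induction n with
  | zero => intro v; cases v <;> simp [level, atNil]
  | succ n ih => exact fun v => lowerSum_nonneg v ih

lemma level_pos (n : ℕ) : ∀ v, wdeg v = n → 0 < level n v := by
  induction n with
  | zero => intro v hv; rcases v with _ | ⟨_ | _, v⟩ <;> simp_all [level, atNil]
  | succ n ih =>
    intro v hv
    exact lowerSum_pos v (k := 0) (N := n) (level_nonneg n) ih (by rintro rfl; simp at hv) hv

lemma level_eq_zero (n : ℕ) : ∀ v, wdeg v ≠ n → level n v = 0 := by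
  induction n with
  | zero => intro v hv; rcases v with _ | ⟨x, v⟩ <;> simp_all [level, atNil]
  | succ n ih =>
    intro v hv
    rw [level, lowerSum_congr (δ := fun _ => 0), lowerSum_zero]
    exact fun u hu => ih u (by omega)

/-- Replacing `cc` by `d` does not decrease `lowerSum`, and mostly increases it. -/
lemma lowerSum_cc (w u : List CD) : ∀ {γ : List CD → ℤ} {k N : ℕ}, (∀ u, 0 ≤ γ u) →
    (∀ u, wdeg u + k = N → 0 < γ u) →
    (∀ u w, γ (u ++ CD.c :: CD.c :: w) ≤ γ (u ++ CD.d :: w)) →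
    (∀ u w, (u ≠ [] ∨ w ≠ []) → wdeg u + wdeg w + 2 + k = N →
      γ (u ++ CD.c :: CD.c :: w) < γ (u ++ CD.d :: w)) →
    lowerSum γ (u ++ CD.c :: CD.c :: w) ≤ lowerSum γ (u ++ CD.d :: w) ∧
    ((u ≠ [] ∨ w ≠ []) → wdeg u + wdeg w + 2 + k = N + 1 →
      lowerSum γ (u ++ CD.c :: CD.c :: w) < lowerSum γ (u ++ CD.d :: w)) := by
  induction u with
  | nil =>
    intro γ k N h0 hp hle hlt
    have hm := lowerSum_mono w (γ := fun u => γ (CD.c :: CD.c :: u))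
      (δ := fun u => γ (CD.d :: u)) fun u => hle [] u
    have h1 := h0 (CD.c :: w)
    simp only [List.nil_append, lowerSum, unlessC_c, zero_add]
    -- Turning d into c gives `γ (c :: w)`; shortening the run cc gives the same term only if `w`
    -- does not start with c. If it does, that term is the strict gain; if `w` starts with d, the
    -- gain comes from turning this d into c; if `w` is empty, there is equality.
    rcases w with _ | ⟨_ | _, w⟩
    · simp only [unlessC_nil]; exact ⟨by omega, by simp⟩
    · simp only [unlessC_c]
      refine ⟨by omega, fun _ hd => ?_⟩
      have := hp (CD.c :: CD.c :: w) (by simp at hd ⊢; omega)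
      omega
    · simp only [unlessC_d]
      refine ⟨by omega, fun _ hd => ?_⟩
      have a1 := hlt [] (CD.c :: w) (by simp) (by simp at hd ⊢; omega)
      have a2 := lowerSum_mono w (γ := fun u => γ (CD.c :: CD.c :: CD.d :: u))
        (δ := fun u => γ (CD.d :: CD.d :: u)) fun u => hle [] (CD.d :: u)
      simp only [List.nil_append, lowerSum] at a1 ⊢
      omega
  | cons x u ih =>
    intro γ k N h0 hp hle hlt
    cases x with
    | d =>
      have a1 := ih (γ := fun v => γ (CD.d :: v)) (k := k + 2) (N := N) (fun _ => h0 _)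
        (fun v hv => hp _ (by simp; omega)) (fun u w => hle (CD.d :: u) w)
        (fun u w _ hd => hlt (CD.d :: u) w (by simp) (by simp; omega))
      have a2 := hle (CD.c :: u) w
      simp only [List.cons_append, lowerSum] at a1 a2 ⊢
      refine ⟨by omega, fun _ hd => ?_⟩
      have a3 := hlt (CD.c :: u) w (by simp) (by simp at hd ⊢; omega)
      simp only [List.cons_append] at a3
      omega
    | c =>
      have a1 := ih (γ := fun v => γ (CD.c :: v)) (k := k + 1) (N := N) (fun _ => h0 _)
        (fun v hv => hp _ (by simp; omega)) (fun u w => hle (CD.c :: u) w)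
        (fun u w _ hd => hlt (CD.c :: u) w (by simp) (by simp; omega))
      -- With `u` empty, the leading c ends its run before d but not before cc, which leaves one
      -- extra positive term on the larger side.
      rcases u with _ | ⟨_ | _, u⟩
      · have a2 := h0 (CD.d :: w)
        simp only [List.cons_append, List.nil_append] at a1 ⊢
        rw [lowerSum, lowerSum.eq_2 γ (CD.d :: w)]
        simp only [unlessC]
        refine ⟨by omega, fun _ hd => ?_⟩
        have a3 := hp (CD.d :: w) (by simp at hd ⊢; omega)
        omega
      · simp only [List.cons_append] at a1 ⊢
        rw [lowerSum, lowerSum.eq_2 γ (CD.c :: (u ++ CD.d :: w))]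
        simp only [unlessC]
        refine ⟨by omega, fun _ hd => ?_⟩
        have a3 := a1.2 (by simp) (by simp at hd ⊢; omega)
        omega
      · have a2 := hle (CD.d :: u) w
        simp only [List.cons_append] at a1 a2 ⊢
        rw [lowerSum, lowerSum.eq_2 γ (CD.d :: (u ++ CD.d :: w))]
        simp only [unlessC]
        refine ⟨by omega, fun _ hd => ?_⟩
        have a3 := hlt (CD.d :: u) w (by simp) (by simp at hd ⊢; omega)
        simp only [List.cons_append] at a3
        omega

/-- Strictness fails only for the bare words cc and d, which both have coefficient 1 in c² + d. -/
lemma level_cc (n : ℕ) :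
    (∀ u w, level n (u ++ CD.c :: CD.c :: w) ≤ level n (u ++ CD.d :: w)) ∧
    (∀ u w, (u ≠ [] ∨ w ≠ []) → wdeg u + wdeg w + 2 = n →
      level n (u ++ CD.c :: CD.c :: w) < level n (u ++ CD.d :: w)) := by
  induction n with
  | zero =>
    refine ⟨fun u w => ?_, fun u w _ h => by omega⟩
    cases u <;> simp [level, atNil]
  | succ n ih =>
    have := fun u w => lowerSum_cc w u (k := 0) (N := n) (level_nonneg n) (level_pos n) ih.1 ih.2
    exact ⟨fun u w => (this u w).1, fun u w => (this u w).2⟩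

/-! ### Pairing with ab-words and flag words -/

/-- The pairing of a function on `cd`-words with a word whose letters `(p, q)` stand for
`p a* + q b*`: for letters `(1, 0)` and `(0, 1)` this is the coefficient of an `ab`-word in the
image of a polynomial under `c = a + b`, `d = ab + ba`. -/
def pair (γ : List CD → ℤ) : List (ℤ × ℤ) → ℤ
  | [] => γ []
  | [x] => (x.1 + x.2) * γ [CD.c]
  | x :: y :: w => (x.1 + x.2) * pair (fun v => γ (CD.c :: v)) (y :: w) +
      (x.1 * y.2 + x.2 * y.1) * pair (fun v => γ (CD.d :: v)) w

lemma pair_induction {motive : List (ℤ × ℤ) → Prop} (nil : motive [])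
    (singleton : ∀ x, motive [x])
    (cons_cons : ∀ x y w, motive (y :: w) → motive w → motive (x :: y :: w)) (w) : motive w := by
  suffices ∀ n, ∀ w : List (ℤ × ℤ), w.length ≤ n → motive w from this _ w le_rfl
  intro n
  induction n with
  | zero =>
    intro w hw
    rw [List.length_eq_zero_iff.1 (Nat.le_zero.1 hw)]; exact nil
  | succ n ih =>
    intro w hw
    rcases w with _ | ⟨x, _ | ⟨y, w⟩⟩
    · exact nil
    · exact singleton x
    · simp only [List.length_cons] at hw
      exact cons_cons x y w (ih _ (by simp; omega)) (ih _ (by omega))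

lemma pair_add (w : List (ℤ × ℤ)) : ∀ γ δ : List CD → ℤ,
    pair (fun v => γ v + δ v) w = pair γ w + pair δ w := by
  induction w using pair_induction with
  | nil => intros; rfl
  | singleton x => intro γ δ; simp only [pair]; ring
  | cons_cons x y w h1 h2 => intro γ δ; simp only [pair, h1, h2]; ring

lemma pair_mul (w : List (ℤ × ℤ)) : ∀ (k : ℤ) (γ : List CD → ℤ),
    pair (fun v => k * γ v) w = k * pair γ w := by
  induction w using pair_induction with
  | nil => intros; rfl
  | singleton x => intro γ δ; simp only [pair]; ring
  | cons_cons x y w h1 h2 => intro γ δ; simp only [pair, h1, h2]; ring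

lemma pair_zero (w : List (ℤ × ℤ)) : pair (fun _ => 0) w = 0 := by
  simpa using pair_mul w 0 fun _ => 0

lemma pair_congr (w : List (ℤ × ℤ)) : ∀ {γ δ : List CD → ℤ},
    (∀ v, wdeg v = w.length → γ v = δ v) → pair γ w = pair δ w := by
  induction w using pair_induction with
  | nil => intro γ δ h; exact h [] rfl
  | singleton x => intro γ δ h; simp only [pair, h [CD.c] (by simp)]
  | cons_cons x y w h1 h2 =>
    intro γ δ h
    have a1 := h1 (γ := fun v => γ (CD.c :: v)) (δ := fun v => δ (CD.c :: v))
      fun v hv => h _ (by simp [hv])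
    have a2 := h2 (γ := fun v => γ (CD.d :: v)) (δ := fun v => δ (CD.d :: v))
      fun v hv => h _ (by simp [hv])
    simp only [pair, a1, a2]

lemma pair_atNil (x : ℤ) (w : List (ℤ × ℤ)) :
    pair (atNil x) w = match w with | [] => x | _ :: _ => 0 := by
  rcases w with _ | ⟨y, _ | ⟨z, w⟩⟩
  · rfl
  · simp [pair, atNil]
  · simp only [pair, atNil, pair_zero]; ring

lemma pair_afterC (γ : List CD → ℤ) (x : ℤ × ℤ) (w : List (ℤ × ℤ)) :
    pair (afterC γ) (x :: w) = (x.1 + x.2) * pair γ w := by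
  rcases w with _ | ⟨y, w⟩
  · rfl
  · have h : pair (fun v => afterC γ (CD.d :: v)) w = 0 := pair_zero w
    rw [pair, h]; simp only [afterC_c]; ring

lemma pair_c_cons (γ : List CD → ℤ) (w : List (ℤ × ℤ)) :
    pair γ ((1, 1) :: w) = pair (fun v => cut γ [] v) w := by
  simp only [cut]
  rw [pair_add, pair_mul]
  rcases w with _ | ⟨y, w⟩
  · simp [pair, afterC]
  · rw [pair_afterC]; simp only [pair]; ring

/-- The letter (1, 1) adds the coefficients of x a w and x b w. As Δ sends both a and b to 1⊗1, this
sum is the coefficient of x⊗w in the coproduct. -/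
theorem pair_append_c (w x : List (ℤ × ℤ)) : ∀ γ : List CD → ℤ,
    pair γ (x ++ (1, 1) :: w) = pair (fun u => pair (fun v => cut γ u v) w) x := by
  induction x using pair_induction with
  | nil => intro γ; exact pair_c_cons γ w
  | singleton x =>
    intro γ
    rw [List.singleton_append, pair.eq_3, pair_c_cons]
    simp only [pair]
    have : ∀ v, cut γ [CD.c] v = cut (fun v => γ (CD.c :: v)) [] v + γ (CD.d :: v) := fun v => rfl
    simp only [this, pair_add]; ring
  | cons_cons x y z h1 h2 =>
    intro γ
    have a1 : pair (fun u => pair (fun v => cut γ (CD.c :: u) v) w) (y :: z) =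
        pair (fun u => pair (fun v => cut (fun v => γ (CD.c :: v)) u v) w) (y :: z) := by
      have : ∀ u, pair (fun v => cut γ (CD.c :: u) v) w =
          pair (fun v => cut (fun v => γ (CD.c :: v)) u v) w +
            atNil (pair (fun v => γ (CD.d :: v)) w) u := by
        intro u
        simp only [cut, pair_add]
        congr 1
        cases u
        · rfl
        · exact pair_zero w
      simp only [this, pair_add, pair_atNil, add_zero]
    have a2 := h1 fun v => γ (CD.c :: v)
    rw [List.cons_append, List.cons_append, pair, pair, h2, a1, ← a2]
    rfl

lemma pair_replicate_a (m : ℕ) : ∀ γ : List CD → ℤ,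
    pair γ (List.replicate m (1, 0)) = γ (List.replicate m CD.c) := by
  induction m with
  | zero => intro γ; rfl
  | succ m ih =>
    intro γ
    rcases m with _ | m
    · simp [pair]
    · have := ih fun v => γ (CD.c :: v)
      simp only [List.replicate_succ] at this ⊢
      rw [pair, this]; simp

lemma lowerSum_replicate_c (m : ℕ) : ∀ γ : List CD → ℤ,
    lowerSum γ (List.replicate (m + 1) CD.c) = γ (List.replicate m CD.c) := by
  induction m with
  | zero => intro γ; simp [lowerSum]
  | succ m ih =>
    intro γ
    have := ih fun v => γ (CD.c :: v)
    rw [List.replicate_succ, lowerSum, this, List.replicate_succ, unlessC_c, zero_add]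

lemma level_replicate_c (m : ℕ) : level m (List.replicate m CD.c) = 1 := by
  induction m with
  | zero => rfl
  | succ m ih => rw [level, lowerSum_replicate_c, ih]

lemma wdeg_replicate_c (m : ℕ) : wdeg (List.replicate m CD.c) = m := by
  induction m with
  | zero => rfl
  | succ m ih => simp [List.replicate_succ, ih]

/-- The algebraic counterpart of choosing the largest member of a chain: a binomial number of
choices, no selected ranks above, and the flag word `x` below. -/
lemma pair_level_append (x : List (ℤ × ℤ)) (m : ℕ) :
    pair (level (x.length + m + 1)) (x ++ (1, 1) :: List.replicate m (1, 0)) =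
      (x.length + m + 2).choose (x.length + 1) * pair (level x.length) x := by
  rw [pair_append_c, ← pair_mul]
  refine pair_congr x fun u hu => ?_
  rw [pair_replicate_a, ← hu, cut_level _ _ _ (by rw [wdeg_replicate_c]), wdeg_replicate_c,
    level_replicate_c]
  ring

/-! ### Chains in Boolean lattices -/

/-- The chains of subsets of `A` whose set of cardinalities is `R`. -/
def chainsIn {α : Type*} (A : Finset α) (R : Set ℕ) : Set (Set (Finset α)) :=
  {C | IsChain (· ≤ ·) C ∧ (∀ X ∈ C, X ⊆ A) ∧ Finset.card '' C = R}

lemma chainsIn_empty {α : Type*} (A : Finset α) : chainsIn A ∅ = {∅} := by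
  ext C
  simp only [chainsIn, Set.image_eq_empty, Set.mem_ofPred_eq, Set.mem_singleton_iff]
  constructor
  · exact fun h => h.2.2
  · rintro rfl; simp [IsChain]

/-- Since `n` exceeds all of `R`, a chain has exactly one member of size `n`, and all its other
members are subsets of that one. -/
lemma card_chainsIn_insert {α : Type*} [Finite α] (A : Finset α) {R : Set ℕ} {n : ℕ}
    (hR : ∀ r ∈ R, r < n) :
    Nat.card (chainsIn A (insert n R)) =
      ∑ X ∈ A.powersetCard n, Nat.card (chainsIn X R) := by
  classical
  have : Fintype α := Fintype.ofFinite α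
  rw [← Finset.sum_coe_sort, ← Nat.card_sigma]
  symm
  have hlt : ∀ {X : Finset α} {C : Set (Finset α)}, C ∈ chainsIn X R → ∀ Y ∈ C, Y.card < n :=
    fun hC Y hY => hR _ (hC.2.2 ▸ Set.mem_image_of_mem _ hY)
  refine Nat.card_eq_of_bijective
    (fun q : (Σ X : A.powersetCard n, chainsIn (X : Finset α) R) =>
      (⟨insert (q.1 : Finset α) (q.2 : Set (Finset α)), ?_⟩ : chainsIn A (insert n R))) ⟨?_, ?_⟩
  · obtain ⟨⟨X, hX⟩, ⟨C, hC⟩⟩ := q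
    rw [Finset.mem_powersetCard] at hX
    refine ⟨hC.1.insert fun Y hY _ => Or.inr (hC.2.1 Y hY), ?_, ?_⟩
    · intro Y hY
      rcases hY with rfl | hY
      · exact hX.1
      · exact (hC.2.1 Y hY).trans hX.1
    · simp only [Set.image_insert_eq, hX.2, hC.2.2]
  · rintro ⟨⟨X, hX⟩, ⟨C, hC⟩⟩ ⟨⟨Y, hY⟩, ⟨D, hD⟩⟩ h
    simp only [Subtype.mk.injEq] at h
    rw [Finset.mem_powersetCard] at hX hY
    have e : X = Y := by
      have : X ∈ insert Y D := h ▸ Set.mem_insert _ _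
      rcases this with h' | h'
      · exact h'
      · exact absurd (hlt hD X h') (by omega)
    subst e
    have hXC : X ∉ C := fun h' => absurd (hlt hC X h') (by omega)
    have hXD : X ∉ D := fun h' => absurd (hlt hD X h') (by omega)
    have e : C = D := by
      have := congrArg (· \ {X}) h
      simpa [Set.insert_sdiff_of_mem, hXC, hXD] using this
    subst e
    rfl
  · rintro ⟨C, hC⟩
    obtain ⟨X, hXC, hXn⟩ : n ∈ Finset.card '' C := hC.2.2 ▸ Set.mem_insert _ _
    have hle : ∀ Y ∈ C, Y.card ≤ n := by
      intro Y hY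
      have : Y.card ∈ insert n R := hC.2.2 ▸ Set.mem_image_of_mem _ hY
      rcases this with h | h
      · exact h.le
      · exact (hR _ h).le
    have hsub : ∀ Y ∈ C, Y ⊆ X := by
      intro Y hY
      rcases hC.1.total hY hXC with h | h
      · exact h
      · exact (Finset.eq_of_subset_of_card_le h (by rw [hXn]; exact hle Y hY)).ge
    have hC' : C \ {X} ∈ chainsIn X R := by
      refine ⟨hC.1.mono Set.sdiff_subset, fun Y hY => hsub Y hY.1, ?_⟩
      ext r
      constructor
      · rintro ⟨Y, hY, rfl⟩
        have : Y.card ∈ insert n R := hC.2.2 ▸ Set.mem_image_of_mem _ hY.1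
        rcases this with h | h
        · exact absurd (Finset.eq_of_subset_of_card_le (hsub Y hY.1) (by omega)) hY.2
        · exact h
      · intro hr
        obtain ⟨Y, hY, rfl⟩ : r ∈ Finset.card '' C := hC.2.2 ▸ Set.mem_insert_of_mem _ hr
        refine ⟨Y, ⟨hY, ?_⟩, rfl⟩
        rintro rfl
        exact absurd (hR _ hr) (by omega)
    refine ⟨⟨⟨X, Finset.mem_powersetCard.2 ⟨hC.2.1 X hXC, hXn⟩⟩, ⟨C \ {X}, hC'⟩⟩, ?_⟩
    simp [hXC]

open Classical in
/-- The letter `a* + b*` if `p` holds and `a*` otherwise. -/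
noncomputable def flagLetter (p : Prop) : ℤ × ℤ := if p then (1, 1) else (1, 0)

/-- Ranks are processed from the top. An unselected rank becomes one more trailing letter a; a
selected rank fixes the largest member, and the count continues inside it with `m = 0`. -/
lemma card_chainsIn {α : Type*} [Finite α] (p : ℕ → Prop) (n : ℕ) : ∀ (m : ℕ) (A : Finset α),
    A.card = n + m + 1 →
    (Nat.card (chainsIn A {r | ∃ i < n, p i ∧ r = i + 1}) : ℤ) =
      pair (level (n + m))
        ((List.range n).map (fun i => flagLetter (p i)) ++ List.replicate m (1, 0)) := by
  induction n with
  | zero =>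
    intro m A _
    simp [chainsIn_empty, pair_replicate_a, level_replicate_c]
  | succ n ih =>
    intro m A hA
    by_cases hp : p n
    · have e : {r | ∃ i < n + 1, p i ∧ r = i + 1} =
          insert (n + 1) {r | ∃ i < n, p i ∧ r = i + 1} := by
        ext r
        simp only [Set.mem_ofPred_eq, Set.mem_insert_iff]
        constructor
        · rintro ⟨i, hi, hpi, rfl⟩
          rcases Nat.lt_succ_iff_lt_or_eq.1 hi with h | rfl
          · exact Or.inr ⟨i, h, hpi, rfl⟩
          · exact Or.inl rfl
        · rintro (rfl | ⟨i, hi, hpi, rfl⟩)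
          · exact ⟨n, by omega, hp, rfl⟩
          · exact ⟨i, by omega, hpi, rfl⟩
      rw [e, card_chainsIn_insert A (by rintro r ⟨i, hi, _, rfl⟩; omega)]
      have h2 := pair_level_append ((List.range n).map fun i => flagLetter (p i)) m
      simp only [List.length_map, List.length_range] at h2
      rw [List.range_succ, List.map_append, List.append_assoc, List.map_singleton,
        List.singleton_append, show flagLetter (p n) = (1, 1) from if_pos hp,
        show n + 1 + m = n + m + 1 by omega, h2]
      push_cast
      rw [Finset.sum_congr rfl (g := fun _ => pair (level n)
        ((List.range n).map fun i => flagLetter (p i)))]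
      · rw [Finset.sum_const, Finset.card_powersetCard, hA, nsmul_eq_mul,
          show n + 1 + m + 1 = n + m + 2 by omega]
      · intro X hX
        have := ih 0 X (by rw [(Finset.mem_powersetCard.1 hX).2])
        simpa using this
    · have e : {r | ∃ i < n + 1, p i ∧ r = i + 1} = {r | ∃ i < n, p i ∧ r = i + 1} := by
        ext r
        constructor
        · rintro ⟨i, hi, hpi, rfl⟩
          rcases Nat.lt_succ_iff_lt_or_eq.1 hi with h | rfl
          · exact ⟨i, h, hpi, rfl⟩
          · exact absurd hpi hp
        · rintro ⟨i, hi, hpi, rfl⟩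
          exact ⟨i, by omega, hpi, rfl⟩
      rw [e, ih (m + 1) A (by omega), List.range_succ, List.map_append, List.append_assoc,
        List.map_singleton, List.singleton_append, show flagLetter (p n) = (1, 0) from if_neg hp,
        List.replicate_succ, show n + 1 + m = n + (m + 1) by omega]

lemma flagF_eq_pair (n : ℕ) (S : Finset (Fin n)) :
    (flagF (BooleanLattice (n + 1)) n S : ℤ) =
      pair (level n) (List.ofFn fun i => flagLetter (i ∈ S)) := by
  have h := card_chainsIn (α := Fin (n + 1)) (fun i => ∃ h : i < n, (⟨i, h⟩ : Fin n) ∈ S) n 0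
    Finset.univ (by simp)
  have e : (List.range n).map (fun i => flagLetter (∃ h : i < n, (⟨i, h⟩ : Fin n) ∈ S)) =
      List.ofFn fun i => flagLetter (i ∈ S) := by
    refine List.ext_getElem (by simp) fun i h1 h2 => ?_
    have : i < n := by simpa using h1
    simp [this]
  simp only [e, List.replicate_zero, List.append_nil, Nat.add_zero] at h
  rw [← h, flagF, ← Nat.card_coe_set_eq]
  congr 4
  ext C
  have : (fun i : Fin n => (i : ℕ) + 1) '' (S : Set (Fin n)) =
      {r | ∃ i < n, (∃ h : i < n, (⟨i, h⟩ : Fin n) ∈ S) ∧ r = i + 1} := by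
    ext r
    constructor
    · rintro ⟨i, hi, rfl⟩
      exact ⟨i, i.2, ⟨i.2, hi⟩, rfl⟩
    · rintro ⟨i, _, ⟨h, hi⟩, rfl⟩
      exact ⟨⟨i, h⟩, hi, rfl⟩
  simp only [this, Finset.subset_univ, implies_true, true_and]
  rfl

/-! ### The `ab`-index -/

lemma pair_append_add (y x : List (ℤ × ℤ)) (p q : ℤ × ℤ) : ∀ γ : List CD → ℤ,
    pair γ (x ++ (p + q) :: y) = pair γ (x ++ p :: y) + pair γ (x ++ q :: y) := by
  induction x using pair_induction with
  | nil =>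
    intro γ
    rcases y with _ | ⟨z, y⟩
    · simp [pair]; ring
    · simp [pair]; ring
  | singleton x =>
    intro γ
    rcases y with _ | ⟨z, y⟩
    · simp [pair]; ring
    · simp [pair]; ring
  | cons_cons x z w h1 h2 =>
    intro γ
    have := h1 fun v => γ (CD.c :: v)
    simp only [List.cons_append] at this ⊢
    simp only [pair, h2, this]
    ring

lemma ofFn_update {β : Type*} {n : ℕ} (f : Fin n → β) (i : Fin n) :
    ∃ x y : List β, ∀ p, List.ofFn (Function.update f i p) = x ++ p :: y := by
  refine ⟨(List.ofFn f).take i, (List.ofFn f).drop (i + 1), fun p => ?_⟩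
  have : List.ofFn (Function.update f i p) = (List.ofFn f).set i p := by
    refine List.ext_getElem (by simp) fun j h1 h2 => ?_
    simp only [List.getElem_ofFn, List.getElem_set, Function.update_apply, Fin.ext_iff]
    simp only [eq_comm]
  rw [this, List.set_eq_take_append_cons_drop]
  simp

lemma pair_update (γ : List CD → ℤ) {n : ℕ} (f : Fin n → ℤ × ℤ) (i : Fin n) :
    pair γ (List.ofFn (Function.update f i (0, 1))) =
      - pair γ (List.ofFn (Function.update f i (1, 0))) +
        pair γ (List.ofFn (Function.update f i (1, 1))) := by
  obtain ⟨x, y, h⟩ := ofFn_update f i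
  rw [h, h, h, show ((1, 1) : ℤ × ℤ) = (0, 1) + (1, 0) by simp, pair_append_add]
  ring

/-- The alternating sum expands (0, 1) = (1, 1) − (1, 0) at every position of `S`. The free letters
`f` allow the induction to set the letter at the newly inserted position. -/
lemma sum_pair_flag (γ : List CD → ℤ) {n : ℕ} (S : Finset (Fin n)) : ∀ f : Fin n → ℤ × ℤ,
    ∑ T ∈ S.powerset, (-1) ^ (S \ T).card *
      pair γ (List.ofFn fun i => if i ∈ T then (1, 1) else if i ∈ S then (1, 0) else f i) =
    pair γ (List.ofFn fun i => if i ∈ S then (0, 1) else f i) := by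
  induction S using Finset.induction_on with
  | empty => intro f; simp
  | insert a S ha ih =>
    intro f
    rw [Finset.sum_powerset_insert ha]
    have h1 : (fun i => if i ∈ insert a S then ((0, 1) : ℤ × ℤ) else f i) =
        Function.update (fun i => if i ∈ S then (0, 1) else f i) a (0, 1) := by
      ext1 i
      by_cases hi : i = a
      · simp [hi]
      · simp [hi]
    have h2 : ∀ x, Function.update (fun i => if i ∈ S then ((0, 1) : ℤ × ℤ) else f i) a x =
        fun i => if i ∈ S then ((0, 1) : ℤ × ℤ) else Function.update f a x i := by
      intro x
      ext1 i
      by_cases hi : i = a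
      · subst hi; simp [ha]
      · simp [hi]
    rw [h1, pair_update, h2, h2, ← ih, ← ih, ← Finset.sum_neg_distrib]
    congr 1
    · refine Finset.sum_congr rfl fun T hT => ?_
      rw [Finset.mem_powerset] at hT
      have haT : a ∉ T := fun h => ha (hT h)
      rw [Finset.insert_sdiff_of_notMem _ haT, Finset.card_insert_of_notMem (by simp [ha]),
        pow_succ]
      have : (fun i => if i ∈ T then ((1, 1) : ℤ × ℤ) else
          if i ∈ insert a S then (1, 0) else f i) =
          fun i => if i ∈ T then (1, 1) else
            if i ∈ S then (1, 0) else Function.update f a (1, 0) i := by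
        ext1 i
        by_cases hi : i = a
        · subst hi; simp [ha]
        · simp [hi]
      rw [this]; ring
    · refine Finset.sum_congr rfl fun T hT => ?_
      rw [Finset.mem_powerset] at hT
      have haT : a ∉ T := fun h => ha (hT h)
      have : (fun i => if i ∈ insert a T then ((1, 1) : ℤ × ℤ) else
          if i ∈ insert a S then (1, 0) else f i) =
          fun i => if i ∈ T then (1, 1) else
            if i ∈ S then (1, 0) else Function.update f a (1, 1) i := by
        ext1 i
        by_cases hi : i = a
        · subst hi; simp [ha, haT]
        · simp [hi]
      have h3 : insert a S \ insert a T = S \ T := by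
        ext i
        by_cases hi : i = a
        · subst hi; simp [ha]
        · simp [hi]
      rw [this, h3]

/-- The letter of the pairing that stands for a letter `a` or `b`. -/
def AB.letter : AB → ℤ × ℤ
  | AB.a => (1, 0)
  | AB.b => (0, 1)

lemma flagH_eq_pair (n : ℕ) (S : Finset (Fin n)) :
    flagH (BooleanLattice (n + 1)) n S = pair (level n) ((abWord n S).toList.map AB.letter) := by
  have h := sum_pair_flag (level n) S fun _ => (1, 0)
  have e : (abWord n S).toList.map AB.letter =
      List.ofFn fun i => if i ∈ S then ((0, 1) : ℤ × ℤ) else (1, 0) := by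
    rw [abWord, FreeMonoid.toList_ofList, List.map_ofFn]
    congr 1
    ext1 i
    by_cases hi : i ∈ S <;> simp [hi, AB.letter]
  rw [e, ← h, flagH]
  refine Finset.sum_congr rfl fun T _ => ?_
  rw [flagF_eq_pair]
  congr! 5 with i
  simp [flagLetter]

/-! ### Coefficients of the substitution -/

lemma coeff_of_mul_nil (x : AB) (Q : ABPoly) :
    (MonoidAlgebra.of ℤ (FreeMonoid AB) (FreeMonoid.of x) * Q).coeff (FreeMonoid.ofList []) = 0 :=
  MonoidAlgebra.coeff_single_mul_of_forall_mul_ne _ _ fun w h =>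
    List.cons_ne_nil x w.toList (congrArg FreeMonoid.toList h)

lemma coeff_of_mul_cons [DecidableEq AB] (x y : AB) (w : List AB) (Q : ABPoly) :
    (MonoidAlgebra.of ℤ (FreeMonoid AB) (FreeMonoid.of x) * Q).coeff (FreeMonoid.ofList (y :: w)) =
      if x = y then Q.coeff (FreeMonoid.ofList w) else 0 := by
  split_ifs with h
  · subst h
    have := MonoidAlgebra.coeff_single_mul_eq_mul_coeff (R := ℤ) (m := FreeMonoid.of x)
      (m₁ := FreeMonoid.ofList (x :: w)) (x := Q) (r := 1) (FreeMonoid.ofList w)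
      (fun v _ => by
        constructor
        · intro h
          have := congrArg FreeMonoid.toList h
          simp only [FreeMonoid.toList_mul, FreeMonoid.toList_of, FreeMonoid.toList_ofList,
            List.singleton_append, List.cons.injEq, true_and] at this
          rw [← this, FreeMonoid.ofList_toList]
        · rintro rfl; rfl)
    rw [one_mul] at this
    exact this
  · refine MonoidAlgebra.coeff_single_mul_of_forall_mul_ne _ _ fun v e => h ?_
    have := congrArg FreeMonoid.toList e
    simp only [FreeMonoid.toList_mul, FreeMonoid.toList_of, FreeMonoid.toList_ofList,
      List.singleton_append, List.cons.injEq] at this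
    exact this.1

lemma pair_letter_cons_c (γ : List CD → ℤ) (h : ∀ v, γ (CD.d :: v) = 0) (x : AB) (w : List AB) :
    pair γ ((x :: w).map AB.letter) = pair (fun v => γ (CD.c :: v)) (w.map AB.letter) := by
  rcases w with _ | ⟨y, w⟩
  · cases x <;> simp [pair, AB.letter]
  · simp only [List.map_cons, pair, h, pair_zero]
    cases x <;> simp [AB.letter]

lemma coeff_lift_toAB [DecidableEq (List CD)] (v : List CD) : ∀ w : List AB,
    (FreeMonoid.lift CD.toAB (FreeMonoid.ofList v)).coeff (FreeMonoid.ofList w) =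
      pair (fun u => if u = v then 1 else 0) (w.map AB.letter) := by
  classical
  induction v with
  | nil =>
    intro w
    have e : (fun u : List CD => if u = [] then (1 : ℤ) else 0) = atNil 1 := by
      ext1 u; cases u <;> simp [atNil]
    rw [e, pair_atNil, FreeMonoid.ofList_nil, map_one, MonoidAlgebra.one_def,
      MonoidAlgebra.coeff_single, Finsupp.single_apply]
    cases w with
    | nil => simp
    | cons x w => exact if_neg (fun h => List.cons_ne_nil x w (congrArg FreeMonoid.toList h).symm)
  | cons x v ih =>
    intro w
    rw [FreeMonoid.ofList_cons, map_mul, FreeMonoid.lift_eval_of]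
    cases x with
    | c =>
      rw [CD.toAB, aVar, bVar, add_mul, MonoidAlgebra.coeff_add, Finsupp.add_apply]
      cases w with
      | nil => simp [pair]
      | cons y w =>
        rw [coeff_of_mul_cons, coeff_of_mul_cons, ih, pair_letter_cons_c _ (by simp)]
        cases y <;> simp
    | d =>
      rw [CD.toAB, aVar, bVar, add_mul, MonoidAlgebra.coeff_add, Finsupp.add_apply, mul_assoc,
        mul_assoc]
      rcases w with _ | ⟨y, _ | ⟨z, w⟩⟩
      · simp [pair]
      · simp only [coeff_of_mul_cons, coeff_of_mul_nil]
        simp [pair]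
      · simp only [coeff_of_mul_cons, ih, List.map_cons, pair]
        cases y <;> cases z <;> simp [AB.letter, pair_zero]

lemma coeff_substAB (Φ : CDPoly) (w : List AB) :
    (substAB Φ).coeff (FreeMonoid.ofList w) =
      pair (fun v => Φ.coeff (FreeMonoid.ofList v)) (w.map AB.letter) := by
  classical
  induction Φ using MonoidAlgebra.induction_linear with
  | zero => simp [pair_zero]
  | add f g hf hg => simp [hf, hg, pair_add]
  | single v r =>
    have := coeff_lift_toAB v.toList w
    rw [FreeMonoid.ofList_toList] at this
    rw [substAB, MonoidAlgebra.lift_single, MonoidAlgebra.coeff_smul, Finsupp.smul_apply, this,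
      smul_eq_mul, ← pair_mul]
    congr 1
    ext1 u
    rw [MonoidAlgebra.coeff_single, Finsupp.single_apply]
    have : v = FreeMonoid.ofList u ↔ u = v.toList := by
      constructor
      · intro h; rw [h, FreeMonoid.toList_ofList]
      · intro h; rw [h, FreeMonoid.ofList_toList]
    simp [this]

lemma eq_zero_of_pair_eq_zero (v : List CD) : ∀ γ : List CD → ℤ,
    (∀ w : List AB, pair γ (w.map AB.letter) = 0) → γ v = 0 := by
  induction v with
  | nil => exact fun γ h => h []
  | cons x v ih =>
    intro γ h
    have hd : ∀ w : List AB, pair (fun v => γ (CD.d :: v)) (w.map AB.letter) = 0 := by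
      intro w
      -- The words abw and bbw have the same contribution from a leading c, while a leading d
      -- contributes only to abw; the difference isolates it.
      have h1 := h (AB.a :: AB.b :: w)
      have h2 := h (AB.b :: AB.b :: w)
      simp only [List.map_cons, pair, AB.letter] at h1 h2
      linarith
    cases x with
    | d => exact ih _ hd
    | c =>
      refine ih (fun v => γ (CD.c :: v)) fun w => ?_
      have h1 := h (AB.a :: w)
      rcases w with _ | ⟨y, w⟩
      · simpa [pair, AB.letter] using h1
      · have h2 := hd w
        simp only [List.map_cons, pair, h2] at h1 ⊢
        simpa [AB.letter] using h1

lemma substAB_injective : Function.Injective substAB := by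
  rw [injective_iff_map_eq_zero]
  intro Φ h
  ext v
  have := eq_zero_of_pair_eq_zero v.toList (fun v => Φ.coeff (FreeMonoid.ofList v)) fun w => by
    rw [← coeff_substAB, h]; simp
  simpa using this

/-- The polynomial with coefficients `level n`. -/
noncomputable def levelPoly (n : ℕ) : CDPoly :=
  MonoidAlgebra.ofCoeff (Finsupp.ofSupportFinite (fun v => level n v.toList) (by
    classical
    refine Set.Finite.subset (s := FreeMonoid.toList ⁻¹' {l | l.length ≤ n}) ?_ ?_
    · have : Finite CD := Finite.intro (n := 2)
        ⟨fun | .c => 0 | .d => 1, fun i => if i = 0 then .c else .d,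
          fun x => by cases x <;> rfl, fun i => by fin_cases i <;> rfl⟩
      exact (List.finite_length_le CD n).preimage FreeMonoid.toList.injective.injOn
    · intro v hv
      have hv : wdeg v.toList = n := by
        by_contra h
        exact hv (level_eq_zero n _ h)
      rw [Set.mem_preimage, Set.mem_ofPred_eq, ← hv]
      generalize v.toList = u
      induction u with
      | nil => simp
      | cons x u ih => cases x <;> simp <;> omega))

lemma coeff_levelPoly (n : ℕ) (v : CDMonomial) : (levelPoly n).coeff v = level n v.toList := rfl

theorem isCDIndex_levelPoly (n : ℕ) : IsCDIndex (BooleanLattice (n + 1)) n (levelPoly n) := by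
  classical
  rw [IsCDIndex]
  ext w
  obtain ⟨w, rfl⟩ := FreeMonoid.ofList.surjective w
  rw [coeff_substAB]
  simp only [coeff_levelPoly, FreeMonoid.toList_ofList]
  rw [abIndex, MonoidAlgebra.coeff_sum, Finset.sum_apply']
  simp only [MonoidAlgebra.coeff_single, Finsupp.single_apply]
  by_cases hw : w.length = n
  · subst hw
    set S : Finset (Fin w.length) := Finset.univ.filter fun i => w[i] = AB.b with hS
    have e : ∀ T, abWord w.length T = FreeMonoid.ofList w ↔ T = S := by
      intro T
      have : ∀ i : Fin w.length, (if i ∈ T then AB.b else AB.a) = w[i] ↔ (i ∈ T ↔ i ∈ S) := by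
        intro i
        simp only [hS, Finset.mem_filter, Finset.mem_univ, true_and]
        generalize w[i] = x
        by_cases h : i ∈ T <;> cases x <;> simp [h]
      rw [abWord, FreeMonoid.ofList.injective.eq_iff, Finset.ext_iff]
      simp only [← this]
      conv_lhs => rhs; rw [← List.ofFn_getElem (xs := w)]
      rw [List.ofFn_inj, funext_iff]
      rfl
    simp only [e, Finset.sum_ite_eq', Finset.mem_univ, if_true]
    rw [flagH_eq_pair, (e S).2 rfl]
    rfl
  -- Words of the wrong length have coefficient zero on both sides, by homogeneity.
  · rw [Finset.sum_eq_zero, pair_congr (δ := fun _ => 0), pair_zero]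
    · intro v hv
      exact level_eq_zero n v (by rw [hv]; simpa using hw)
    · intro S _
      refine if_neg fun h => hw ?_
      rw [← FreeMonoid.toList_ofList w, ← h, abWord]
      simp

theorem existsUnique_isCDIndex (n : ℕ) :
    ∃! Φ : CDPoly, IsCDIndex (BooleanLattice (n + 1)) n Φ :=
  ⟨levelPoly n, isCDIndex_levelPoly n, fun _ h =>
    substAB_injective (h.trans (isCDIndex_levelPoly n).symm)⟩

theorem beta_eq_level (v : CDMonomial) : beta v = level (degree v) v.toList := by
  have h := (existsUnique_isCDIndex (degree v)).exists
  rw [beta, cdIndex, dif_pos h,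
    (existsUnique_isCDIndex (degree v)).unique h.choose_spec (isCDIndex_levelPoly _)]
  rfl

/-! ### The coefficients of the tangent -/

section
open PowerSeries

/-- The power series of `tanh (x / 2) / 2`. -/
noncomputable def halfTanh : PowerSeries ℝ := C (1 / 2 : ℝ) - (1 + exp ℝ)⁻¹

lemma constantCoeff_one_add_exp : constantCoeff (1 + exp ℝ) ≠ 0 := by
  rw [map_add, map_one, constantCoeff_exp]; norm_num

lemma two_mul_C_half : (C (1 / 2 : ℝ) : PowerSeries ℝ) * 2 = 1 := by
  rw [show (2 : PowerSeries ℝ) = C (2 : ℝ) from (map_ofNat C 2).symm, ← map_mul]; norm_num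

lemma derivative_halfTanh : derivative ℝ halfTanh = C (1 / 4 : ℝ) - halfTanh * halfTanh := by
  have h := PowerSeries.mul_inv_cancel _ constantCoeff_one_add_exp
  have h4 : (C (1 / 4 : ℝ) : PowerSeries ℝ) = C (1 / 2) * C (1 / 2) := by
    rw [← map_mul]; norm_num
  rw [halfTanh, map_sub, derivative_C, derivative_inv', map_add, derivative_exp,
    Derivation.map_one_eq_zero, h4]
  linear_combination (1 + exp ℝ)⁻¹ * h - (1 + exp ℝ)⁻¹ * two_mul_C_half

/-- From 1/(e^x + 1) = 1/(e^x − 1) − 2/(e^{2x} − 1), which ties the coefficients to Bernoulli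
numbers and so to zeta values. -/
lemma X_mul_halfTanh : X * halfTanh = X * C (1 / 2 : ℝ) - bernoulliPowerSeries ℝ +
    rescale (2 : ℝ) (bernoulliPowerSeries ℝ) := by
  have h := PowerSeries.mul_inv_cancel _ constantCoeff_one_add_exp
  have h1 := bernoulliPowerSeries_mul_exp_sub_one ℝ
  have h2 := congrArg (rescale (2 : ℝ)) h1
  have h3 := exp_pow_eq_rescale_exp (A := ℝ) 2
  rw [map_mul, map_sub, map_one, rescale_X] at h2
  push_cast at h3
  rw [← h3, show (C (2 : ℝ) : PowerSeries ℝ) = 2 from map_ofNat C 2] at h2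
  have hne : exp ℝ - 1 ≠ 0 := by
    intro h0
    rw [h0, mul_zero] at h1
    exact X_ne_zero h1.symm
  have key : (bernoulliPowerSeries ℝ - rescale (2 : ℝ) (bernoulliPowerSeries ℝ)) * (1 + exp ℝ) =
      X := by
    refine mul_right_cancel₀ hne ?_
    linear_combination (exp ℝ + 1) * h1 - h2
  rw [halfTanh]
  linear_combination (1 + exp ℝ)⁻¹ * key -
    (bernoulliPowerSeries ℝ - rescale (2 : ℝ) (bernoulliPowerSeries ℝ)) * h

lemma coeff_halfTanh (n : ℕ) : coeff n halfTanh = (if n = 0 then 1 / 2 else 0) +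
    (2 ^ (n + 1) - 1) * (bernoulli (n + 1) / (n + 1).factorial : ℝ) := by
  have h := congrArg (coeff (n + 1)) X_mul_halfTanh
  rw [coeff_succ_X_mul, map_add, map_sub, coeff_succ_X_mul, coeff_rescale, coeff_C,
    bernoulliPowerSeries, coeff_mk] at h
  rw [h]
  simp only [eq_ratCast, Rat.cast_div, Rat.cast_natCast]
  ring

lemma coeff_halfTanh_even (n : ℕ) : coeff (2 * n) halfTanh = 0 := by
  rw [coeff_halfTanh]
  rcases n with _ | n
  · norm_num
  · rw [bernoulli_eq_zero_of_odd ⟨n + 1, rfl⟩ (by omega)]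
    simp

/-- The coefficient of `x ^ (2 * a + 1)` in the Taylor series of `tan x`. -/
noncomputable def tanCoeff (a : ℕ) : ℝ := (-1) ^ a * 4 ^ (a + 1) * coeff (2 * a + 1) halfTanh

lemma tanCoeff_zero : tanCoeff 0 = 1 := by
  rw [tanCoeff, coeff_halfTanh, show 2 * 0 + 1 + 1 = 2 from rfl, bernoulli_two]
  norm_num

lemma sum_antidiagonal_halfTanh (a : ℕ) :
    ∑ p ∈ Finset.HasAntidiagonal.antidiagonal (2 * a + 2), coeff p.1 halfTanh * coeff p.2 halfTanh =
      ∑ p ∈ Finset.HasAntidiagonal.antidiagonal a,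
        coeff (2 * p.1 + 1) halfTanh * coeff (2 * p.2 + 1) halfTanh := by
  symm
  refine Finset.sum_of_injOn (fun p => (2 * p.1 + 1, 2 * p.2 + 1)) ?_ ?_ ?_ fun _ _ => rfl
  · rintro ⟨i, j⟩ _ ⟨k, l⟩ _ h
    simp only [Prod.mk.injEq] at h ⊢
    omega
  · rintro ⟨i, j⟩ h
    simp only [Finset.mem_coe, Finset.HasAntidiagonal.mem_antidiagonal] at h ⊢
    omega
  · rintro ⟨i, j⟩ h1 h2
    rw [Finset.HasAntidiagonal.mem_antidiagonal] at h1
    simp only at h1 ⊢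
    rcases Nat.even_or_odd' i with ⟨k, rfl | rfl⟩
    · rw [coeff_halfTanh_even, zero_mul]
    · refine absurd ⟨(k, a - k), ?_, ?_⟩ h2
      · simp only [Finset.mem_coe, Finset.HasAntidiagonal.mem_antidiagonal]; omega
      · simp only [Prod.mk.injEq, true_and]; omega

/-- The coefficient form of tan' = 1 + tan², obtained from the Riccati equation
`derivative_halfTanh`. -/
theorem tanCoeff_succ (a : ℕ) : (2 * a + 3) * tanCoeff (a + 1) =
    ∑ i ∈ Finset.range (a + 1), tanCoeff i * tanCoeff (a - i) := by
  have h := congrArg (coeff (2 * a + 2)) derivative_halfTanh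
  rw [coeff_derivative, map_sub, coeff_C, if_neg (by omega), coeff_mul,
    sum_antidiagonal_halfTanh] at h
  rw [← Finset.Nat.sum_antidiagonal_eq_sum_range_succ_mk fun p : ℕ × ℕ =>
    tanCoeff p.1 * tanCoeff p.2]
  have h2 : ∑ p ∈ Finset.HasAntidiagonal.antidiagonal a, tanCoeff p.1 * tanCoeff p.2 =
      (-1) ^ a * 4 ^ (a + 2) * ∑ p ∈ Finset.HasAntidiagonal.antidiagonal a,
        coeff (2 * p.1 + 1) halfTanh * coeff (2 * p.2 + 1) halfTanh := by
    rw [Finset.mul_sum]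
    refine Finset.sum_congr rfl fun p hp => ?_
    rw [← Finset.HasAntidiagonal.mem_antidiagonal.1 hp, tanCoeff, tanCoeff]
    ring
  have h3 : ∑ p ∈ Finset.HasAntidiagonal.antidiagonal a,
        coeff (2 * p.1 + 1) halfTanh * coeff (2 * p.2 + 1) halfTanh =
      - (coeff (2 * a + 2 + 1) halfTanh * (2 * a + 3)) := by
    push_cast at h
    linear_combination h
  rw [h2, h3, tanCoeff, show 2 * (a + 1) + 1 = 2 * a + 2 + 1 by ring]
  ring

end

/-! ### Tangent coefficients as moments: log-convexity and ratio bounds -/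

/-- The squares of the poles of the tangent, inverted. -/
noncomputable def tanNode (m : ℕ) : ℝ := (2 / (Real.pi * (2 * m + 1))) ^ 2

/-- Euler's value of ζ(2a + 2), from which the even-indexed terms, a fraction 1/4^{a+1} of the sum,
are removed. -/
lemma hasSum_tanCoeff (a : ℕ) : HasSum (fun m => 2 * tanNode m ^ (a + 1)) (tanCoeff a) := by
  have hz := hasSum_zeta_nat (k := a + 1) (by omega)
  set z : ℝ := (-1 : ℝ) ^ (a + 1 + 1) * (2 : ℝ) ^ (2 * (a + 1) - 1) * Real.pi ^ (2 * (a + 1)) *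
    bernoulli (2 * (a + 1)) / (2 * (a + 1)).factorial with hz'
  have h1 : HasSum (fun n : ℕ => 1 / ((2 * n : ℕ) : ℝ) ^ (2 * (a + 1)))
      ((1 / 4 ^ (a + 1)) * z) := by
    convert! hz.mul_left ((1 : ℝ) / 4 ^ (a + 1)) using 1
    ext1 n
    push_cast
    rw [mul_pow, pow_mul 2 2]
    norm_num
    ring
  have h2 : Summable fun n : ℕ => 1 / ((2 * n + 1 : ℕ) : ℝ) ^ (2 * (a + 1)) :=
    hz.summable.comp_injective (i := fun n => 2 * n + 1) fun i j h => by
      simp only at h; omega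
  have h3 : (1 / 4 ^ (a + 1)) * z + ∑' n : ℕ, 1 / ((2 * n + 1 : ℕ) : ℝ) ^ (2 * (a + 1)) = z :=
    (HasSum.even_add_odd (f := fun n : ℕ => 1 / (n : ℝ) ^ (2 * (a + 1))) h1 h2.hasSum).unique hz
  have h4 : HasSum (fun n : ℕ => 1 / ((2 * n + 1 : ℕ) : ℝ) ^ (2 * (a + 1)))
      ((1 - 1 / 4 ^ (a + 1)) * z) := by
    rw [show (1 - 1 / 4 ^ (a + 1)) * z = ∑' n : ℕ, 1 / ((2 * n + 1 : ℕ) : ℝ) ^ (2 * (a + 1)) by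
      linear_combination -h3]
    exact h2.hasSum
  convert! h4.mul_left (2 * (4 / Real.pi ^ 2) ^ (a + 1)) using 1
  · ext1 m
    rw [tanNode]
    push_cast
    have h5 : (2 * m + 1 : ℝ) ≠ 0 := by positivity
    have h6 := Real.pi_ne_zero
    rw [← pow_mul, div_pow, mul_pow, pow_mul 2 2, pow_mul Real.pi 2, div_pow]
    field_simp
    norm_num
  · have hp : Real.pi ≠ 0 := Real.pi_ne_zero
    have h4 : (4 : ℝ) ^ (a + 1) ≠ 0 := by positivity
    rw [tanCoeff, coeff_halfTanh, if_neg (by omega), hz',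
      show 2 * (a + 1) - 1 = 2 * a + 1 by omega, show 2 * a + 1 + 1 = 2 * (a + 1) by ring]
    rw [show (2 : ℝ) ^ (2 * (a + 1)) = 4 ^ (a + 1) by rw [pow_mul]; norm_num,
      show (2 : ℝ) ^ (2 * a + 1) = 4 ^ (a + 1) / 2 by rw [pow_succ, pow_mul, pow_succ]; norm_num; ring,
      pow_mul Real.pi 2, div_pow]
    field_simp
    ring

lemma tanNode_pos (m : ℕ) : 0 < tanNode m := by
  have := Real.pi_pos
  rw [tanNode]; positivity

lemma tanNode_lt {m k : ℕ} (h : m < k) : tanNode k < tanNode m := by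
  have h0 := Real.pi_pos
  have : (m : ℝ) < k := by exact_mod_cast h
  rw [tanNode, tanNode]
  gcongr

lemma tanCoeff_pos (a : ℕ) : 0 < tanCoeff a :=
  hasSum_lt (f := fun _ => (0 : ℝ)) (i := 0)
    (fun m => by have := tanNode_pos m; positivity)
    (by have := tanNode_pos 0; positivity) hasSum_zero (hasSum_tanCoeff a)

/-- The tangent coefficients are strictly log-convex. -/
lemma tanCoeff_sq_lt (a : ℕ) :
    tanCoeff (a + 1) * tanCoeff (a + 1) < tanCoeff a * tanCoeff (a + 2) := by
  have h0 := tanCoeff_pos a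
  -- This `t` minimises the positive quadratic form Σ 2 x^{a+1} (x − t)² over the nodes; its minimum
  -- being positive is the strict Cauchy–Schwarz inequality, as the nodes are not all equal.
  set t := tanCoeff (a + 1) / tanCoeff a with ht
  have hs : HasSum (fun m => 2 * tanNode m ^ (a + 1) * (tanNode m - t) ^ 2)
      (tanCoeff (a + 2) - 2 * t * tanCoeff (a + 1) + t ^ 2 * tanCoeff a) := by
    convert! ((hasSum_tanCoeff (a + 2)).sub ((hasSum_tanCoeff (a + 1)).mul_left (2 * t))).add
      ((hasSum_tanCoeff a).mul_left (t ^ 2)) using 1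
    ext1 m; ring
  obtain ⟨i, hi⟩ : ∃ i, tanNode i ≠ t := by
    by_contra! h
    exact (tanNode_lt zero_lt_one).ne ((h 1).trans (h 0).symm)
  have hpos := hasSum_lt (f := fun _ => (0 : ℝ)) (i := i)
    (fun m => by have := tanNode_pos m; positivity)
    (by
      have := tanNode_pos i
      have : tanNode i - t ≠ 0 := sub_ne_zero.2 hi
      positivity) hasSum_zero hs
  have e : tanCoeff (a + 1) = t * tanCoeff a := by rw [ht]; field_simp
  rw [e] at hpos ⊢
  nlinarith

/-- The constant lies above the largest node 4/π² ≈ 0.4053, and its square is still below 1/6, as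
`weight_odd_lt` requires. -/
lemma tanCoeff_succ_lt (a : ℕ) : tanCoeff (a + 1) < 51 / 125 * tanCoeff a := by
  have hs : HasSum (fun m => 2 * tanNode m ^ (a + 1) * (51 / 125 - tanNode m))
      (51 / 125 * tanCoeff a - tanCoeff (a + 1)) := by
    convert! ((hasSum_tanCoeff a).mul_left (51 / 125)).sub (hasSum_tanCoeff (a + 1)) using 1
    ext1 m; ring
  have h0 : tanNode 0 < 51 / 125 := by
    have h := Real.pi_gt_d2
    rw [tanNode]
    simp only [Nat.cast_zero, mul_zero, zero_add, mul_one]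
    rw [div_pow, div_lt_iff₀ (by positivity)]
    nlinarith
  have hm : ∀ m, 0 < 51 / 125 - tanNode m := by
    intro m
    rcases Nat.eq_zero_or_pos m with rfl | h
    · linarith
    · have := tanNode_lt h; linarith
  have := hasSum_lt (f := fun _ => (0 : ℝ)) (i := 0)
    (fun m => by have := tanNode_pos m; have := hm m; positivity)
    (by have := tanNode_pos 0; have := hm 0; positivity) hasSum_zero hs
  linarith

/-- The ratios of consecutive tangent coefficients increase. -/
lemma tanCoeff_succ_mul_lt {i j : ℕ} (h : i < j) :
    tanCoeff (i + 1) * tanCoeff j < tanCoeff i * tanCoeff (j + 1) := by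
  induction j, h using Nat.le_induction with
  | base => exact tanCoeff_sq_lt i
  | succ j _ ih =>
    have h1 := tanCoeff_sq_lt j
    have a0 := tanCoeff_pos i
    have a1 := tanCoeff_pos (i + 1)
    have a2 := tanCoeff_pos j
    have a3 := tanCoeff_pos (j + 1)
    have a4 := tanCoeff_pos (j + 2)
    refine lt_of_mul_lt_mul_right ?_ a2.le
    calc tanCoeff (i + 1) * tanCoeff (j + 1) * tanCoeff j
        = (tanCoeff (i + 1) * tanCoeff j) * tanCoeff (j + 1) := by ring
      _ < (tanCoeff i * tanCoeff (j + 1)) * tanCoeff (j + 1) := by gcongr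
      _ = tanCoeff i * (tanCoeff (j + 1) * tanCoeff (j + 1)) := by ring
      _ < tanCoeff i * (tanCoeff j * tanCoeff (j + 2)) := by gcongr
      _ = tanCoeff i * tanCoeff (j + 1 + 1) * tanCoeff j := by ring

lemma tanCoeff_mul_lt (k : ℕ) {a b : ℕ} (ha : 1 ≤ a) (hb : 1 ≤ b) :
    tanCoeff (k + a) * tanCoeff (k + b) < tanCoeff k * tanCoeff (k + a + b) := by
  have step : ∀ a, tanCoeff (k + a + 1) * tanCoeff (k + a + b) <
      tanCoeff (k + a) * tanCoeff (k + a + 1 + b) := by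
    intro a
    have := tanCoeff_succ_mul_lt (i := k + a) (j := k + a + b) (by omega)
    rwa [show k + a + 1 + b = k + a + b + 1 by ring]
  induction a, ha using Nat.le_induction with
  | base => simpa using step 0
  | succ a _ ih =>
    have h1 := step a
    have a0 := tanCoeff_pos k
    have a1 := tanCoeff_pos (k + a)
    have a2 := tanCoeff_pos (k + a + 1)
    refine lt_of_mul_lt_mul_right ?_ a1.le
    calc tanCoeff (k + (a + 1)) * tanCoeff (k + b) * tanCoeff (k + a)
        = tanCoeff (k + a + 1) * (tanCoeff (k + a) * tanCoeff (k + b)) := by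
          rw [← add_assoc]; ring
      _ < tanCoeff (k + a + 1) * (tanCoeff k * tanCoeff (k + a + b)) := by gcongr
      _ = tanCoeff k * (tanCoeff (k + a + 1) * tanCoeff (k + a + b)) := by ring
      _ < tanCoeff k * (tanCoeff (k + a) * tanCoeff (k + a + 1 + b)) := by gcongr
      _ = tanCoeff k * tanCoeff (k + (a + 1) + b) * tanCoeff (k + a) := by
          rw [← add_assoc]; ring

lemma tanCoeff_mul_le (k a b : ℕ) :
    tanCoeff (k + a) * tanCoeff (k + b) ≤ tanCoeff k * tanCoeff (k + a + b) := by
  rcases Nat.eq_zero_or_pos a with rfl | ha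
  · simp
  rcases Nat.eq_zero_or_pos b with rfl | hb
  · simp [mul_comm]
  exact (tanCoeff_mul_lt k ha hb).le

lemma tanCoeff_one : tanCoeff 1 = 1 / 3 := by
  have h := tanCoeff_succ 0
  simp [tanCoeff_zero] at h
  linarith

lemma tanCoeff_two : tanCoeff 2 = 2 / 15 := by
  have h := tanCoeff_succ 1
  simp [Finset.sum_range_succ, tanCoeff_zero, tanCoeff_one] at h
  linarith

/-- Ratios increase, so from index 1 on they are at least τ_2/τ_1 = 2/5, and (2/5)³ > 1/18. At index
0 the bound fails, since τ_3 = 17/315 < 1/18. -/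
lemma tanCoeff_lt_add_three {i : ℕ} (hi : 1 ≤ i) : tanCoeff i < 18 * tanCoeff (i + 3) := by
  have step : ∀ j, 1 ≤ j → 2 / 5 * tanCoeff j ≤ tanCoeff (j + 1) := by
    intro j hj
    obtain ⟨j, rfl⟩ := Nat.exists_eq_add_of_le hj
    have := tanCoeff_mul_le 1 1 j
    rw [show 1 + 1 + j = 1 + j + 1 by ring, show 1 + 1 = 2 from rfl, tanCoeff_one,
      tanCoeff_two] at this
    linarith
  have h1 := step i hi
  have h2 := step (i + 1) (by omega)
  have h3 := step (i + 2) (by omega)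
  have := tanCoeff_pos i
  linarith

lemma tanCoeff_pow_mul_le {i : ℕ} (hi : 1 ≤ i) (m : ℕ) :
    (1 / 18) ^ m * tanCoeff i ≤ tanCoeff (i + 3 * m) := by
  induction m with
  | zero => simp
  | succ m ih =>
    have := tanCoeff_lt_add_three (i := i + 3 * m) (by omega)
    rw [pow_succ, show i + 3 * (m + 1) = i + 3 * m + 3 by ring]
    linarith

lemma tanCoeff_pow_mul_lt {i : ℕ} (hi : 1 ≤ i) {m : ℕ} (hm : 1 ≤ m) :
    (1 / 18) ^ m * tanCoeff i < tanCoeff (i + 3 * m) := by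
  obtain ⟨m, rfl⟩ := Nat.exists_eq_add_of_le' hm
  have := tanCoeff_lt_add_three (i := i + 3 * m) (by omega)
  have := tanCoeff_pow_mul_le hi m
  rw [pow_succ, show i + 3 * (m + 1) = i + 3 * m + 3 by ring]
  linarith

/-! ### Words without two adjacent letters `c` -/

/-- The coefficient of a `cd`-word of degree `n`, divided by `(n + 1)!`. -/
noncomputable def weight (v : List CD) : ℝ := level (wdeg v) v / (wdeg v + 1).factorial

lemma level_eq_weight (v : List CD) :
    (level (wdeg v) v : ℝ) = weight v * (wdeg v + 1).factorial := by
  rw [weight, div_mul_cancel₀]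
  exact_mod_cast Nat.factorial_ne_zero _

lemma weight_append_c {u w : List CD} (hu : NotEndC u) (hw : NotStartC w) :
    weight (u ++ CD.c :: w) = weight u * weight w / 2 := by
  have h : (2 * level (wdeg u + wdeg w + 1) (u ++ CD.c :: w) : ℝ) =
      (wdeg u + wdeg w + 2).choose (wdeg u + 1) * (level (wdeg u) u * level (wdeg w) w) := by
    exact_mod_cast level_append_c hu hw
  have hc : ((wdeg u + wdeg w + 2).choose (wdeg u + 1) * (wdeg u + 1).factorial *
      (wdeg w + 1).factorial : ℝ) = (wdeg u + wdeg w + 2).factorial := by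
    have := Nat.choose_mul_factorial_mul_factorial
      (show wdeg u + 1 ≤ wdeg u + wdeg w + 2 by omega)
    rw [show wdeg u + wdeg w + 2 - (wdeg u + 1) = wdeg w + 1 by omega] at this
    exact_mod_cast this
  have hd : wdeg (u ++ CD.c :: w) = wdeg u + wdeg w + 1 := by simp; omega
  have f1 : ((wdeg u + wdeg w + 2).factorial : ℝ) ≠ 0 := by exact_mod_cast Nat.factorial_ne_zero _
  rw [level_eq_weight, level_eq_weight] at h
  rw [weight, hd, div_eq_iff f1, ← hc]
  linear_combination h / 2

lemma lowerSum_replicate_d (n : ℕ) : ∀ γ : List CD → ℤ,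
    lowerSum γ (List.replicate n CD.d) = ∑ i ∈ Finset.range n,
      γ (List.replicate i CD.d ++ CD.c :: List.replicate (n - 1 - i) CD.d) := by
  induction n with
  | zero => intro γ; rfl
  | succ n ih =>
    intro γ
    rw [List.replicate_succ, lowerSum, ih, Finset.sum_range_succ', add_comm]
    congr 1
    refine Finset.sum_congr rfl fun i hi => ?_
    rw [show n + 1 - 1 - (i + 1) = n - 1 - i by omega]
    rfl

lemma wdeg_replicate_d (n : ℕ) : wdeg (List.replicate n CD.d) = 2 * n := by
  induction n with
  | zero => rfl
  | succ n ih => simp [List.replicate_succ, ih]; ring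

lemma notEndC_replicate_d (n : ℕ) : NotEndC (List.replicate n CD.d) := by
  intro u h
  have : CD.c ∈ List.replicate n CD.d := by rw [h]; simp
  simp [List.mem_replicate] at this

lemma notStartC_replicate_d (n : ℕ) : NotStartC (List.replicate n CD.d) := by
  intro u h
  have : CD.c ∈ List.replicate n CD.d := by rw [h]; simp
  simp [List.mem_replicate] at this

/-- In a power of d, `lowerSum` can only turn one d into c, and this isolated c splits the weight.
-/
lemma weight_replicate_d_succ (a : ℕ) : (2 * a + 3) * weight (List.replicate (a + 1) CD.d) =
    1 / 2 * ∑ i ∈ Finset.range (a + 1),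
      weight (List.replicate i CD.d) * weight (List.replicate (a - i) CD.d) := by
  have h := lowerSum_replicate_d (a + 1) (level (2 * a + 1))
  have h1 : level (wdeg (List.replicate (a + 1) CD.d)) (List.replicate (a + 1) CD.d) =
      lowerSum (level (2 * a + 1)) (List.replicate (a + 1) CD.d) := by
    rw [wdeg_replicate_d]; rfl
  have h2 : ((lowerSum (level (2 * a + 1)) (List.replicate (a + 1) CD.d) : ℤ) : ℝ) =
      (2 * a + 2).factorial * (1 / 2 * ∑ i ∈ Finset.range (a + 1),
        weight (List.replicate i CD.d) * weight (List.replicate (a - i) CD.d)) := by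
    rw [h]
    push_cast
    rw [Finset.mul_sum, Finset.mul_sum]
    refine Finset.sum_congr rfl fun i hi => ?_
    rw [Finset.mem_range] at hi
    have hd : wdeg (List.replicate i CD.d ++ CD.c :: List.replicate (a + 1 - 1 - i) CD.d) =
        2 * a + 1 := by
      simp only [wdeg_append, wdeg_c, wdeg_replicate_d]; omega
    have := level_eq_weight (List.replicate i CD.d ++ CD.c :: List.replicate (a + 1 - 1 - i) CD.d)
    rw [hd, weight_append_c (notEndC_replicate_d _) (notStartC_replicate_d _)] at this
    rw [Nat.add_sub_cancel] at this
    rw [this]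
    ring
  have f1 : ((2 * a + 2).factorial : ℝ) ≠ 0 := by exact_mod_cast Nat.factorial_ne_zero _
  have f2 : ((2 * (a + 1) + 1).factorial : ℝ) = (2 * a + 3) * (2 * a + 2).factorial := by
    rw [show 2 * (a + 1) + 1 = 2 * a + 2 + 1 by ring, Nat.factorial_succ]; push_cast; ring
  have h3 := level_eq_weight (List.replicate (a + 1) CD.d)
  rw [h1, h2, wdeg_replicate_d, f2] at h3
  refine mul_left_cancel₀ f1 ?_
  linear_combination -h3

lemma weight_replicate_d (a : ℕ) : weight (List.replicate a CD.d) = tanCoeff a / 2 ^ a := by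
  induction a using Nat.strong_induction_on with
  | _ a ih =>
    rcases a with _ | a
    · simp [weight, level, atNil, tanCoeff_zero]
    · have h := weight_replicate_d_succ a
      have h' : ∑ i ∈ Finset.range (a + 1),
          weight (List.replicate i CD.d) * weight (List.replicate (a - i) CD.d) =
          (∑ i ∈ Finset.range (a + 1), tanCoeff i * tanCoeff (a - i)) / 2 ^ a := by
        rw [Finset.sum_div]
        refine Finset.sum_congr rfl fun i hi => ?_
        rw [Finset.mem_range] at hi
        rw [ih i hi, ih (a - i) (by omega), div_mul_div_comm, ← pow_add,
          show i + (a - i) = a by omega]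
      rw [h', ← tanCoeff_succ] at h
      have : (2 * a + 3 : ℝ) ≠ 0 := by positivity
      refine mul_left_cancel₀ this ?_
      rw [h, pow_succ]
      field_simp

/-- The word `d ^ a₁ c d ^ a₂ c ⋯ c d ^ b` for a list `(a₁, a₂, …)`. -/
def blockWord : List ℕ → ℕ → List CD
  | [], b => List.replicate b CD.d
  | a :: L, b => List.replicate a CD.d ++ CD.c :: blockWord L b

lemma exists_blockWord (v : List CD) : ∃ L b, v = blockWord L b := by
  induction v with
  | nil => exact ⟨[], 0, rfl⟩
  | cons x v ih =>
    obtain ⟨L, b, rfl⟩ := ih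
    cases x with
    | c => exact ⟨0 :: L, b, rfl⟩
    | d =>
      rcases L with _ | ⟨a, L⟩
      · exact ⟨[], b + 1, rfl⟩
      · exact ⟨(a + 1) :: L, b, rfl⟩

lemma wdeg_blockWord (L : List ℕ) (b : ℕ) :
    wdeg (blockWord L b) = 2 * (L.sum + b) + L.length := by
  induction L with
  | nil => simp [blockWord, wdeg_replicate_d]
  | cons a L ih => simp [blockWord, wdeg_replicate_d, ih]; ring

lemma exists_cc_of_zero_mem (L : List ℕ) (b : ℕ) (h : 0 ∈ L.tail) :
    ∃ u w, blockWord L b = u ++ CD.c :: CD.c :: w := by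
  induction L with
  | nil => simp at h
  | cons a L ih =>
    rcases L with _ | ⟨x, L⟩
    · simp at h
    · rw [List.tail_cons, List.mem_cons] at h
      rcases h with rfl | h
      · exact ⟨List.replicate a CD.d, blockWord L b, rfl⟩
      · obtain ⟨u, w, e⟩ := ih h
        exact ⟨List.replicate a CD.d ++ CD.c :: u, w, by rw [blockWord, e]; simp⟩

/-- Each c and each d contributes a factor 1/2. The tail of `L` lists the interior blocks; the end
blocks may be empty. -/
lemma weight_blockWord (L : List ℕ) (b : ℕ) (h : ∀ x ∈ L.tail, 1 ≤ x) :
    weight (blockWord L b) =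
      (L.map tanCoeff).prod * tanCoeff b / 2 ^ (L.length + L.sum + b) := by
  induction L with
  | nil => simp [blockWord, weight_replicate_d]
  | cons a L ih =>
    have hL : NotStartC (blockWord L b) := by
      rcases L with _ | ⟨x, L⟩
      · exact notStartC_replicate_d b
      · obtain ⟨x, rfl⟩ := Nat.exists_eq_add_of_le' (h x (by simp))
        intro w hw
        simp [blockWord, List.replicate_succ] at hw
    rw [blockWord, weight_append_c (notEndC_replicate_d a) hL, weight_replicate_d,
      ih fun x hx => h x (List.mem_of_mem_tail hx)]
    simp only [List.map_cons, List.prod_cons, List.length_cons, List.sum_cons]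
    rw [show L.length + 1 + (a + L.sum) + b = a + (L.length + L.sum + b) + 1 by ring, pow_succ,
      pow_add 2 a]
    field_simp

/-! ### Merging blocks -/

/-- Log-convexity based at index 1 gives τ_x τ_y ≤ (1/3) τ_{x+y−1}: each merger gains a factor 1/3
and lowers the total index by one. -/
lemma prod_tanCoeff_le (L : List ℕ) (hL : ∀ x ∈ L, 1 ≤ x) : ∀ {x i : ℕ}, 1 ≤ x →
    i + L.length = x + L.sum →
    tanCoeff x * (L.map tanCoeff).prod ≤ (1 / 3) ^ L.length * tanCoeff i := by
  induction L with
  | nil => intro x i hx h; simp at h; subst h; simp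
  | cons y L ih =>
    intro x i hx h
    have hy := hL y (by simp)
    obtain ⟨x, rfl⟩ := Nat.exists_eq_add_of_le hx
    obtain ⟨y, rfl⟩ := Nat.exists_eq_add_of_le hy
    simp only [List.length_cons, List.sum_cons] at h
    have h1 := ih (fun z hz => hL z (by simp [hz])) (x := 1 + x + y) (i := i) (by omega) (by omega)
    have h2 := tanCoeff_mul_le 1 x y
    rw [tanCoeff_one] at h2
    have h3 : 0 ≤ (L.map tanCoeff).prod := List.prod_nonneg fun z hz => by
      obtain ⟨w, _, rfl⟩ := List.mem_map.1 hz
      exact (tanCoeff_pos w).le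
    rw [List.map_cons, List.prod_cons, List.length_cons, pow_succ]
    calc _ = tanCoeff (1 + x) * tanCoeff (1 + y) * (L.map tanCoeff).prod := by ring
      _ ≤ 1 / 3 * tanCoeff (1 + x + y) * (L.map tanCoeff).prod := by gcongr
      _ = 1 / 3 * (tanCoeff (1 + x + y) * (L.map tanCoeff).prod) := by ring
      _ ≤ 1 / 3 * ((1 / 3) ^ L.length * tanCoeff i) := by gcongr
      _ = _ := by ring

lemma tanCoeff_mul_mul_le (a b i : ℕ) :
    tanCoeff a * tanCoeff i * tanCoeff b ≤ tanCoeff (a + i + b) := by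
  have h1 := tanCoeff_mul_le 0 a i
  have h2 := tanCoeff_mul_le 0 (a + i) b
  simp only [zero_add, tanCoeff_zero, one_mul] at h1 h2
  have := tanCoeff_pos b
  nlinarith

lemma tanCoeff_mul_mul_lt {a b i : ℕ} (hi : 1 ≤ i) (hab : a ≠ 0 ∨ b ≠ 0) :
    tanCoeff a * tanCoeff i * tanCoeff b < tanCoeff (a + i + b) := by
  have h1 := tanCoeff_mul_le 0 a i
  have h2 := tanCoeff_mul_le 0 (a + i) b
  simp only [zero_add, tanCoeff_zero, one_mul] at h1 h2
  have := tanCoeff_pos b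
  rcases hab with h | h
  · have h1 := tanCoeff_mul_lt 0 (a := a) (b := i) (by omega) hi
    simp only [zero_add, tanCoeff_zero, one_mul] at h1
    nlinarith
  · have h2 := tanCoeff_mul_lt 0 (a := a + i) (b := b) (by omega) (by omega)
    simp only [zero_add, tanCoeff_zero, one_mul] at h2
    nlinarith

/-- The comparison of an odd number of interior blocks with a single one. -/
lemma odd_blocks_le {a b x m n : ℕ} {L : List ℕ} (hL : ∀ y ∈ L, 1 ≤ y) (hx : 1 ≤ x)
    (hm : L.length = 2 * m) (hn : a + (x + L.sum) + b + m = n) :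
    tanCoeff a * (tanCoeff x * (L.map tanCoeff).prod) * tanCoeff b ≤ 2 ^ m * tanCoeff n ∧
    ((a ≠ 0 ∨ b ≠ 0 ∨ L ≠ []) →
      tanCoeff a * (tanCoeff x * (L.map tanCoeff).prod) * tanCoeff b < 2 ^ m * tanCoeff n) := by
  have hsum : L.length ≤ L.sum := by
    clear hm hn
    induction L with
    | nil => simp
    | cons y L ih =>
      have := ih fun z hz => hL z (by simp [hz])
      have := hL y (by simp)
      simp only [List.length_cons, List.sum_cons]; omega
  obtain ⟨i, hi⟩ := Nat.exists_eq_add_of_le hsum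
  have h1 := prod_tanCoeff_le L hL (x := x) (i := x + i) hx (by omega)
  have ha := tanCoeff_pos a
  have hb := tanCoeff_pos b
  have h2 : tanCoeff a * (tanCoeff x * (L.map tanCoeff).prod) * tanCoeff b ≤
      (1 / 3) ^ (2 * m) * (tanCoeff a * tanCoeff (x + i) * tanCoeff b) := by
    rw [← hm]
    calc _ ≤ tanCoeff a * ((1 / 3) ^ L.length * tanCoeff (x + i)) * tanCoeff b := by gcongr
      _ = _ := by ring
  have h3 := tanCoeff_mul_mul_le a b (x + i)
  -- The 2m mergers give 1/9 for each of the m pairs; the allowed factor 2 per pair turns this into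
  -- 1/18, paid for by raising the index by 3.
  have e : (2 : ℝ) ^ m * (1 / 18) ^ m = (1 / 3) ^ (2 * m) := by
    rw [pow_mul, ← mul_pow]; norm_num
  have h4 := tanCoeff_pow_mul_le (i := a + (x + i) + b) (by omega) m
  rw [show a + (x + i) + b + 3 * m = n by omega] at h4
  have h5 : (0 : ℝ) < 2 ^ m := by positivity
  have h6 : (0 : ℝ) < (1 / 3) ^ (2 * m) := by positivity
  have h7 : (1 / 3 : ℝ) ^ (2 * m) * tanCoeff (a + (x + i) + b) ≤ 2 ^ m * tanCoeff n := by
    rw [← e, mul_assoc]; gcongr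
  refine ⟨h2.trans ((mul_le_mul_of_nonneg_left h3 h6.le).trans h7), fun hne => ?_⟩
  by_cases hm0 : m = 0
  · subst hm0
    have hLn : L = [] := List.length_eq_zero_iff.1 (by omega)
    have h3' := tanCoeff_mul_mul_lt (a := a) (b := b) (i := x + i) (by omega)
      (hne.imp_right fun h => h.resolve_right fun h' => h' hLn)
    exact h2.trans_lt ((mul_lt_mul_of_pos_left h3' h6).trans_le h7)
  · have h4' := tanCoeff_pow_mul_lt (i := a + (x + i) + b) (by omega) (m := m) (by omega)
    rw [show a + (x + i) + b + 3 * m = n by omega] at h4'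
    refine h2.trans_lt ((mul_le_mul_of_nonneg_left h3 h6.le).trans_lt ?_)
    rw [← e, mul_assoc]
    exact mul_lt_mul_of_pos_left h4' h5

lemma weight_even_lt {L : List ℕ} {b n : ℕ} (hL : ∀ x ∈ L.tail, 1 ≤ x)
    (hd : 2 * (L.sum + b) + L.length = 2 * n + 2) (hne : ¬ (L = [0, n] ∧ b = 0)) :
    weight (blockWord L b) < tanCoeff n / 2 ^ (n + 2) := by
  rw [weight_blockWord L b hL]
  have hn := tanCoeff_pos n
  rcases L with _ | ⟨a, _ | ⟨x, L⟩⟩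
  -- No letter c at all: the competitor is d^{n+1}, and a ratio below 1/2 suffices.
  · obtain rfl : b = n + 1 := by simp at hd; omega
    have := tanCoeff_succ_lt n
    simp only [List.map_nil, List.prod_nil, List.length_nil, List.sum_nil, one_mul, zero_add]
    rw [div_lt_div_iff₀ (by positivity) (by positivity), pow_succ 2 (n + 1)]
    have : (0 : ℝ) < 2 ^ (n + 1) := by positivity
    nlinarith
  · simp at hd; omega
  · simp only [List.length_cons, List.sum_cons] at hd
    obtain ⟨m, hm⟩ : ∃ m, L.length = 2 * m := ⟨L.length / 2, by omega⟩
    have h := (odd_blocks_le (a := a) (b := b) (x := x) (m := m) (n := n) (L := L)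
      (fun y hy => hL y (by simp [hy])) (hL x (by simp)) hm (by omega)).2 (by
        by_contra! hc
        obtain ⟨rfl, rfl, rfl⟩ := hc
        refine hne ⟨?_, rfl⟩
        simp at hd
        rw [hd])
    simp only [List.map_cons, List.prod_cons, List.length_cons, List.sum_cons]
    rw [div_lt_div_iff₀ (by positivity) (by positivity),
      show L.length + 1 + 1 + (a + (x + L.sum)) + b = m + (n + 2) by omega, pow_add 2 m]
    have := mul_lt_mul_of_pos_right h (show (0 : ℝ) < 2 ^ (n + 2) by positivity)
    linarith

lemma weight_odd_lt {L : List ℕ} {b n : ℕ} (hL : ∀ x ∈ L.tail, 1 ≤ x)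
    (hd : 2 * (L.sum + b) + L.length = 2 * n + 5)
    (h1 : ¬ (L = [0, 1, n] ∧ b = 0)) (h2 : ¬ (L = [0, n, 1] ∧ b = 0)) :
    weight (blockWord L b) < tanCoeff n / (3 * 2 ^ (n + 4)) := by
  rw [weight_blockWord L b hL]
  have hn := tanCoeff_pos n
  rcases L with _ | ⟨a, _ | ⟨x, _ | ⟨y, L⟩⟩⟩
  · simp at hd; omega
  -- One letter c: the product is at most τ_{n+2}, and two steps of the ratio bound bring it below
  -- τ_n / 6.
  · have hab : a + b = n + 2 := by simp at hd; omega
    have g1 := tanCoeff_succ_lt n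
    have g2 := tanCoeff_succ_lt (n + 1)
    have g3 := tanCoeff_mul_le 0 a b
    simp only [zero_add, tanCoeff_zero, one_mul, hab] at g3
    have g4 : tanCoeff a * tanCoeff b < tanCoeff n / 6 := by
      have : tanCoeff (n + 1 + 1) = tanCoeff (n + 2) := rfl
      linarith
    simp only [List.map_cons, List.map_nil, List.prod_cons, List.prod_nil, List.length_cons,
      List.length_nil, List.sum_cons, List.sum_nil, mul_one]
    rw [div_lt_div_iff₀ (by positivity) (by positivity),
      show 0 + 1 + (a + 0) + b = n + 3 by omega, pow_succ 2 (n + 3)]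
    have : (0 : ℝ) < 2 ^ (n + 3) := by positivity
    nlinarith
  · simp at hd; omega
  · simp only [List.length_cons, List.sum_cons] at hd
    have hx := hL x (by simp)
    have hy := hL y (by simp)
    obtain ⟨x, rfl⟩ := Nat.exists_eq_add_of_le hx
    obtain ⟨y, rfl⟩ := Nat.exists_eq_add_of_le hy
    obtain ⟨m, hm⟩ : ∃ m, L.length = 2 * m := ⟨L.length / 2, by omega⟩
    have h := odd_blocks_le (a := a) (b := b) (x := 1 + x + y) (m := m) (n := n) (L := L)
      (fun y hy => hL y (by simp [hy])) (by omega) hm (by omega)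
    have ha := tanCoeff_pos a
    have hb := tanCoeff_pos b
    have hp : 0 < (L.map tanCoeff).prod := List.prod_pos fun z hz => by
      obtain ⟨w, _, rfl⟩ := List.mem_map.1 hz
      exact tanCoeff_pos w
    have key : 3 * (tanCoeff a * (tanCoeff (1 + x) * (tanCoeff (1 + y) *
        (L.map tanCoeff).prod)) * tanCoeff b) < 2 ^ m * tanCoeff n := by
      have e : 3 * (tanCoeff a * (tanCoeff (1 + x) * (tanCoeff (1 + y) *
        (L.map tanCoeff).prod)) * tanCoeff b) = tanCoeff a * ((3 * (tanCoeff (1 + x) *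
          tanCoeff (1 + y))) * (L.map tanCoeff).prod) * tanCoeff b := by ring
      rw [e]
      -- Merging the first two interior blocks costs exactly 1/3 when one of them is a single d.
      -- Strictness comes from the remaining blocks if there are any, and otherwise from strict
      -- log-convexity, as both excluded words have such a block.
      by_cases hc : a ≠ 0 ∨ b ≠ 0 ∨ L ≠ []
      · refine lt_of_le_of_lt ?_ (h.2 hc)
        have := tanCoeff_mul_le 1 x y
        rw [tanCoeff_one] at this
        have : 3 * (tanCoeff (1 + x) * tanCoeff (1 + y)) ≤ tanCoeff (1 + x + y) := by linarith
        gcongr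
      · push Not at hc
        obtain ⟨rfl, rfl, rfl⟩ := hc
        refine lt_of_lt_of_le ?_ h.1
        simp at hd
        have := tanCoeff_mul_lt 1 (a := x) (b := y)
          (by
            by_contra h0
            obtain rfl : x = 0 := by omega
            refine h1 ⟨?_, rfl⟩
            simp; omega)
          (by
            by_contra h0
            obtain rfl : y = 0 := by omega
            refine h2 ⟨?_, rfl⟩
            simp; omega)
        rw [tanCoeff_one] at this
        have : 3 * (tanCoeff (1 + x) * tanCoeff (1 + y)) < tanCoeff (1 + x + y) := by linarith
        gcongr
    simp only [List.map_cons, List.prod_cons, List.length_cons, List.sum_cons]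
    rw [div_lt_div_iff₀ (by positivity) (by positivity),
      show L.length + 1 + 1 + 1 + (a + (1 + x + (1 + y + L.sum))) + b = m + (n + 4) by omega,
      pow_add 2 m]
    have := mul_lt_mul_of_pos_right key (show (0 : ℝ) < 2 ^ (n + 4) by positivity)
    linarith

/-- It suffices to compare words without two adjacent letters `c`. -/
lemma level_lt_of_blockWord {N : ℕ} (hN : 3 ≤ N) {M : ℤ} {P : List CD → Prop}
    (hP : ∀ v, P v → level N v = M)
    (h : ∀ L b, (∀ x ∈ L.tail, 1 ≤ x) → wdeg (blockWord L b) = N → P (blockWord L b) ∨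
      level N (blockWord L b) < M) (v : List CD) (hv : wdeg v = N) : P v ∨ level N v < M := by
  -- Induction on length, since replacing cc by d keeps the degree and shortens the word; degree at
  -- least 3 rules out the non-strict case cc.
  obtain ⟨k, hk⟩ : ∃ k, v.length = k := ⟨_, rfl⟩
  induction k generalizing v with
  | zero =>
    rw [List.length_eq_zero_iff.1 hk] at hv
    simp at hv; omega
  | succ k ih =>
    obtain ⟨L, b, rfl⟩ := exists_blockWord v
    by_cases hL : 0 ∈ L.tail
    · obtain ⟨u, w, e⟩ := exists_cc_of_zero_mem L b hL
      rw [e] at hv hk ⊢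
      simp only [wdeg_append, wdeg_c] at hv
      right
      have h1 : u ≠ [] ∨ w ≠ [] := by
        by_contra! hc
        obtain ⟨rfl, rfl⟩ := hc
        simp at hv; omega
      refine ((level_cc N).2 u w h1 (by omega)).trans_le ?_
      rcases ih (u ++ CD.d :: w) (by simp only [wdeg_append, wdeg_d]; omega)
        (by simp at hk ⊢; omega) with h2 | h2
      · exact (hP _ h2).le
      · exact h2.le
    · exact h L b (fun x hx => Nat.one_le_iff_ne_zero.2 fun h0 => hL (h0 ▸ hx)) hv

lemma level_lt_of_weight {N : ℕ} {v w : List CD} (hv : wdeg v = N) (hw : wdeg w = N)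
    (h : weight v < weight w) : level N v < level N w := by
  have h1 := level_eq_weight v
  have h2 := level_eq_weight w
  rw [hv] at h1
  rw [hw] at h2
  have h3 : (0 : ℝ) < (N + 1).factorial := by exact_mod_cast Nat.factorial_pos _
  have : (level N v : ℝ) < level N w := by
    rw [h1, h2]; gcongr
  exact_mod_cast this

theorem level_even {n : ℕ} (hn : 1 ≤ n) (v : List CD) (hv : wdeg v = 2 * n + 2) :
    v = blockWord [0, n] 0 ∨ level (2 * n + 2) v < level (2 * n + 2) (blockWord [0, n] 0) := by
  refine level_lt_of_blockWord (by omega)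
    (P := fun v => v = blockWord [0, n] 0) (by rintro v rfl; rfl) (fun L b hL hd => ?_) v hv
  by_cases hc : L = [0, n] ∧ b = 0
  · left; rw [hc.1, hc.2]
  · right
    refine level_lt_of_weight hd (by rw [wdeg_blockWord]; simp) ?_
    rw [wdeg_blockWord] at hd
    rw [weight_blockWord [0, n] 0 (by simpa using hn)]
    have := weight_even_lt hL hd hc
    simpa [tanCoeff_zero, add_comm] using this

theorem level_odd {n : ℕ} (hn : 1 ≤ n) :
    level (2 * n + 5) (blockWord [0, 1, n] 0) = level (2 * n + 5) (blockWord [0, n, 1] 0) ∧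
    ∀ v : List CD, wdeg v = 2 * n + 5 →
      (v = blockWord [0, 1, n] 0 ∨ v = blockWord [0, n, 1] 0) ∨
      level (2 * n + 5) v < level (2 * n + 5) (blockWord [0, 1, n] 0) := by
  have d1 : wdeg (blockWord [0, 1, n] 0) = 2 * n + 5 := by rw [wdeg_blockWord]; simp; ring
  have d2 : wdeg (blockWord [0, n, 1] 0) = 2 * n + 5 := by rw [wdeg_blockWord]; simp; ring
  have w1 : weight (blockWord [0, 1, n] 0) = tanCoeff n / (3 * 2 ^ (n + 4)) := by
    rw [weight_blockWord _ _ (by simpa using hn)]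
    simp [tanCoeff_zero, tanCoeff_one]
    rw [show 3 + (1 + n) = n + 4 by ring]; field_simp
  have w2 : weight (blockWord [0, n, 1] 0) = tanCoeff n / (3 * 2 ^ (n + 4)) := by
    rw [weight_blockWord _ _ (by simpa using hn)]
    simp [tanCoeff_zero, tanCoeff_one]
    rw [show 3 + (n + 1) = n + 4 by ring]; field_simp
  have e : level (2 * n + 5) (blockWord [0, 1, n] 0) =
      level (2 * n + 5) (blockWord [0, n, 1] 0) := by
    have h1 := level_eq_weight (blockWord [0, 1, n] 0)
    have h2 := level_eq_weight (blockWord [0, n, 1] 0)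
    rw [d1, w1] at h1
    rw [d2, w2] at h2
    exact_mod_cast h1.trans h2.symm
  refine ⟨e, fun v hv => ?_⟩
  refine level_lt_of_blockWord (by omega) (P := fun v => v = blockWord [0, 1, n] 0 ∨
    v = blockWord [0, n, 1] 0) ?_ (fun L b hL hd => ?_) v hv
  · rintro v (rfl | rfl)
    · rfl
    · exact e.symm
  · by_cases h1 : L = [0, 1, n] ∧ b = 0
    · left; left; rw [h1.1, h1.2]
    by_cases h2 : L = [0, n, 1] ∧ b = 0
    · left; right; rw [h2.1, h2.2]
    right
    refine level_lt_of_weight hd d1 ?_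
    rw [w1]
    rw [wdeg_blockWord] at hd
    exact weight_odd_lt hL hd h1 h2

/-! ### The list notation and the maxima -/

lemma ofList_cons (m : ℕ) {L : List ℕ} (hL : L ≠ []) : ofList (m :: L) = c ^ m * d * ofList L := by
  rcases L with _ | ⟨x, L⟩
  · exact absurd rfl hL
  · simp [ofList, mul_assoc]

lemma ofList_replicate_append (k : ℕ) {L : List ℕ} (hL : L ≠ []) :
    ofList (List.replicate k 0 ++ L) = d ^ k * ofList L := by
  induction k with
  | zero => simp
  | succ k ih =>
    rw [List.replicate_succ, List.cons_append, ofList_cons _ (by simp [hL]), ih, pow_zero,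
      one_mul, pow_succ', mul_assoc]

lemma ofList_one : ofList [1] = c := by simp [ofList]

lemma toList_d_pow (n : ℕ) : (d ^ n).toList = List.replicate n CD.d := by
  induction n with
  | zero => rfl
  | succ n ih => rw [pow_succ', FreeMonoid.toList_mul, ih]; rfl

lemma degree_eq_wdeg (v : CDMonomial) : degree v = wdeg v.toList := rfl

lemma mem_maxima {N : ℕ} {v : CDMonomial} : v ∈ maxima N ↔
    wdeg v.toList = N ∧ ∀ w : List CD, wdeg w = N → level N w ≤ level N v.toList := by
  constructor
  · rintro ⟨h1, h2⟩
    refine ⟨h1, fun w hw => ?_⟩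
    have := h2 (FreeMonoid.ofList w) hw
    rw [beta_eq_level, beta_eq_level, h1, degree_eq_wdeg, FreeMonoid.toList_ofList, hw] at this
    exact this
  · rintro ⟨h1, h2⟩
    refine ⟨h1, fun w hw => ?_⟩
    rw [beta_eq_level, beta_eq_level, hw, degree_eq_wdeg v, h1]
    exact h2 _ hw

lemma toList_c_dpow_c (n : ℕ) : (c * d ^ n * c).toList = blockWord [0, n] 0 := by
  simp only [FreeMonoid.toList_mul, toList_d_pow]
  simp [blockWord, c]

lemma maxima_even {n : ℕ} (hn : 1 ≤ n) : maxima (2 * n + 2) = {c * d ^ n * c} := by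
  have hd : wdeg (blockWord [0, n] 0) = 2 * n + 2 := by rw [wdeg_blockWord]; simp
  ext v
  rw [mem_maxima, Set.mem_singleton_iff, ← FreeMonoid.toList.injective.eq_iff, toList_c_dpow_c]
  constructor
  · rintro ⟨h1, h2⟩
    exact (level_even hn _ h1).resolve_right (h2 _ hd).not_gt
  · intro h
    rw [h]
    refine ⟨hd, fun w hw => ?_⟩
    rcases level_even hn w hw with rfl | h
    · exact le_rfl
    · exact h.le

lemma mem_maxima_two : c * d ^ 0 * c ∈ maxima (2 * 0 + 2) := by
  rw [mem_maxima, toList_c_dpow_c]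
  refine ⟨rfl, fun w hw => ?_⟩
  -- In degree 2 the words cc and d tie with coefficient 1, so cc is a maximum but not the only one.
  rcases w with _ | ⟨_ | _, _ | ⟨_ | _, _ | ⟨_ | _, w⟩⟩⟩ <;> simp at hw <;>
    simp [level, lowerSum, atNil, blockWord]

lemma maxima_odd {n : ℕ} (hn : 1 ≤ n) :
    maxima (2 * n + 5) = {c * d * c * d ^ n * c, c * d ^ n * c * d * c} := by
  have d1 : wdeg (blockWord [0, 1, n] 0) = 2 * n + 5 := by rw [wdeg_blockWord]; simp; ring
  have d2 : wdeg (blockWord [0, n, 1] 0) = 2 * n + 5 := by rw [wdeg_blockWord]; simp; ring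
  have e1 : (c * d * c * d ^ n * c).toList = blockWord [0, 1, n] 0 := by
    simp only [FreeMonoid.toList_mul, toList_d_pow]
    simp [blockWord, c, d]
  have e2 : (c * d ^ n * c * d * c).toList = blockWord [0, n, 1] 0 := by
    simp only [FreeMonoid.toList_mul, toList_d_pow]
    simp [blockWord, c, d]
  obtain ⟨he, h⟩ := level_odd hn
  ext v
  rw [mem_maxima, Set.mem_insert_iff, Set.mem_singleton_iff, ← FreeMonoid.toList.injective.eq_iff,
    ← FreeMonoid.toList.injective.eq_iff (b := c * d ^ n * c * d * c), e1, e2]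
  constructor
  · rintro ⟨h1, h2⟩
    exact (h _ h1).resolve_right (h2 _ d1).not_gt
  · intro hv
    have hM : wdeg v.toList = 2 * n + 5 ∧
        level (2 * n + 5) v.toList = level (2 * n + 5) (blockWord [0, 1, n] 0) := by
      rcases hv with hv | hv
      · rw [hv]; exact ⟨d1, rfl⟩
      · rw [hv]; exact ⟨d2, he.symm⟩
    refine ⟨hM.1, fun w hw => ?_⟩
    rw [hM.2]
    rcases h w hw with (rfl | rfl) | h
    · exact le_rfl
    · exact he.ge
    · exact h.le

end BooleanCD

theorem theoremt :
    -- the `cd`-index of every Boolean lattice exists and is unique, so that `β` is meaningful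
    (∀ n : ℕ, ∃! Φ : BooleanCD.CDPoly,
      BooleanCD.IsCDIndex (BooleanCD.BooleanLattice (n + 1)) n Φ) ∧
    -- even degree: `c dⁿ c` is a maximum
    (∀ n : ℕ, BooleanCD.c * BooleanCD.d ^ n * BooleanCD.c ∈ BooleanCD.maxima (2 * n + 2)) ∧
    -- and for `n ≥ 1` it is the only one; in the list notation it is `(1, 0, …, 0, 1)`
    (∀ n : ℕ, 1 ≤ n →
      BooleanCD.maxima (2 * n + 2) = {BooleanCD.c * BooleanCD.d ^ n * BooleanCD.c} ∧
      BooleanCD.c * BooleanCD.d ^ n * BooleanCD.c =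
        BooleanCD.ofList ([1] ++ List.replicate (n - 1) 0 ++ [1])) ∧
    -- odd degree: the maxima are `c d c dⁿ c` and `c dⁿ c d c`;
    -- in the list notation they are `(1, 1, 0, …, 0, 1)` and `(1, 0, …, 0, 1, 1)`
    (∀ n : ℕ, 1 ≤ n →
      BooleanCD.maxima (2 * n + 5) =
        {BooleanCD.c * BooleanCD.d * BooleanCD.c * BooleanCD.d ^ n * BooleanCD.c,
         BooleanCD.c * BooleanCD.d ^ n * BooleanCD.c * BooleanCD.d * BooleanCD.c} ∧
      BooleanCD.c * BooleanCD.d * BooleanCD.c * BooleanCD.d ^ n * BooleanCD.c =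
        BooleanCD.ofList ([1, 1] ++ List.replicate (n - 1) 0 ++ [1]) ∧
      BooleanCD.c * BooleanCD.d ^ n * BooleanCD.c * BooleanCD.d * BooleanCD.c =
        BooleanCD.ofList ([1] ++ List.replicate (n - 1) 0 ++ [1, 1])) := by
  open BooleanCD in
  refine ⟨existsUnique_isCDIndex, fun n => ?_, fun n hn => ⟨maxima_even hn, ?_⟩,
    fun n hn => ⟨maxima_odd hn, ?_, ?_⟩⟩
  · rcases Nat.eq_zero_or_pos n with rfl | hn
    · exact mem_maxima_two
    · rw [maxima_even hn]; rfl
  all_goals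
    obtain ⟨k, rfl⟩ := Nat.exists_eq_add_of_le' hn
    rw [Nat.add_sub_cancel]
  · rw [List.append_assoc, List.singleton_append, ofList_cons 1 (by simp),
      ofList_replicate_append _ (by simp), ofList_one, pow_one, pow_succ']
    simp only [mul_assoc]
  · rw [List.append_assoc, List.cons_append, List.singleton_append, ofList_cons 1 (by simp),
      ofList_cons 1 (by simp), ofList_replicate_append _ (by simp), ofList_one, pow_one, pow_succ']
    simp only [mul_assoc]
  · rw [List.append_assoc, List.singleton_append, ofList_cons 1 (by simp),
      ofList_replicate_append _ (by simp), ofList_cons 1 (by simp), ofList_one, pow_one, pow_succ']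
    simp only [mul_assoc]
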